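/- Let $K$ be an imaginary quadratic field of class number one with ring of integers $\mathcal O$, let $\ell$ be a rational prime that splits in $\mathcal O$ (so $(\ell)=\lambda\bar\lambda$ with distinct prime ideals), and let $\mathfrak a$ be a nonzero ideal of $\mathcal O$ prime to $(\ell)$. Let $\Gamma=\Gamma_1(\mathfrak a)=\left\{\begin{pmatrix} a&b\\c&d\end{pmatrix}\in \mathrm{SL}_2(\mathcal O): c\equiv d-1\equiv 0 \bmod \mathfrak a\right\}$, and let $k$ be a field of characteristic $\ell$ (for example $k=\mathbb F_\ell$ or $k=\overline{\mathbb F}_\ell$). Let $V$ be a right $k[\mathrm M_2(\mathcal O)]$-module. For a prime element $\pi$ of $\mathcal O$, write $\Gamma\begin{pmatrix}\pi&0\\0&1\end{pmatrix}\Gamma=\bigsqcup_i\gamma_i\Gamma$. The Hecke operator $T_\pi$ on $H^1(\Gamma,V)$ is given on cocycles by $$(T_\pi c)(g)=\sum_i c(\gamma_{j(i)}^{-1}g\gamma_i)\cdot\gamma_i^{\iota},\qquad \gamma^\iota=\det(\gamma)\gamma^{-1},$$ where $j(i)$ is the index with $\gamma_{j(i)}^{-1}g\gamma_i\in\Gamma$.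 For a set $S$ of prime elements of $\mathcal O$, let $\mathbb H_S\subseteq \mathrm{End}_k H^1(\Gamma,V)$ be the $k$-subalgebra generated by the $T_\pi$, $\pi\in S$. An eigenvalue system is a ring homomorphism $\Phi:\mathbb H_S\to k$. It occurs in $H^1(\Gamma,V)$ if there is a nonzero $a\in H^1(\Gamma,V)$ with $Ta=\Phi(T)a$ for all $T\in\mathbb H_S$. It is identified with the family $(\Phi(T_\pi))_{\pi\in S}$, so that systems occurring for different $V$ can be compared. For fixed $K,\ell,\mathfrak a,k$: (1) As $E$ ranges over all finite-dimensional right $k[\mathrm{GL}_2(\mathcal O/(\ell))]$-modules, only finitely many eigenvalue systems $(\Phi(T_\pi))_{\pi\nmid\ell}$ occur in $H^1(\Gamma_1(\mathfrak a),E)$. (For $\pi\nmid\ell$, the definition of $T_\pi$ only involves the action on $E$ of matrices that are invertible modulo $\ell$.) (2) As $E$ ranges over all finite-dimensional right $k[\mathrm{GL}_2(\mathcal O/(\ell))]$-modules equipped with an extension of the action to the multiplicative monoid $\mathrm M_2(\mathcal O/(\ell))$, so that $T_\pi$ is defined for every prime $\pi$, only finitely many eigenvalue systems $(\Phi(T_\pi))_{\pi}$,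 $\pi$ running over all prime elements, occur in $H^1(\Gamma_1(\mathfrak a),E)$. -/

import Mathlib

open scoped MatrixGroups NumberField

namespace BianchiHecke

universe u v w

/-- `M₂(R)`: two by two matrices over `R`. -/
abbrev M2 (R : Type u) := Matrix (Fin 2) (Fin 2) R

section RightModules

variable {k : Type v} [Field k] {V : Type w} [AddCommGroup V] [Module k V]
variable {R : Type u} [CommRing R]

/-!
A right `k[M]`-module, for a monoid `M`, is a `k`-vector space `V` with a representation `ρ` of the
opposite monoid `Mᵐᵒᵖ` on it; the vector `v · m` is `ρ (MulOpposite.op m) v`.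
-/

/-- A right `k[M₂(R/I)]`-module, regarded as a right `k[M₂(R)]`-module through reduction mod `I`. -/
def inflate (I : Ideal R) (ρ : Representation k (M2 (R ⧸ I))ᵐᵒᵖ V) :
    Representation k (M2 R)ᵐᵒᵖ V :=
  ρ.comp (MonoidHom.op ((Ideal.Quotient.mk I).mapMatrix : M2 R →+* M2 (R ⧸ I)).toMonoidHom)

open Classical in
/-- A right `k[GL₂(A)]`-module, regarded as a right `k[M₂(A)]`-module on which the non-invertible
matrices act as zero. (Below this is only used with matrices that are invertible in `M₂(A)`, for
which the action is the given one.) -/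
noncomputable def extendByZero {A : Type u} [CommRing A]
    (ρ : Representation k (GL (Fin 2) A)ᵐᵒᵖ V) : Representation k (M2 A)ᵐᵒᵖ V where
  toFun m := if h : IsUnit m.unop then ρ (MulOpposite.op h.unit) else 0
  map_one' := by
    have h : IsUnit (MulOpposite.unop (1 : (M2 A)ᵐᵒᵖ)) := by simp
    have h1 : h.unit = 1 := by ext1; simp
    rw [dif_pos h, h1]; simp
  map_mul' m n := by
    have key : IsUnit (m * n).unop ↔ IsUnit n.unop ∧ IsUnit m.unop := by
      rw [MulOpposite.unop_mul, Matrix.isUnit_iff_isUnit_det, Matrix.det_mul, IsUnit.mul_iff,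
        ← Matrix.isUnit_iff_isUnit_det, ← Matrix.isUnit_iff_isUnit_det]
    by_cases hn : IsUnit n.unop
    · by_cases hm : IsUnit m.unop
      · have hmn := key.2 ⟨hn, hm⟩
        have h1 : hmn.unit = hn.unit * hm.unit := by ext1; simp
        rw [dif_pos hmn, dif_pos hn, dif_pos hm, h1, MulOpposite.op_mul, map_mul]
      · rw [dif_neg (fun h => hm (key.1 h).2), dif_neg hm, zero_mul]
    · rw [dif_neg (fun h => hn (key.1 h).1), dif_neg hn, mul_zero]

end RightModules

section Cohomology

variable {k : Type v} [Field k] {V : Type w} [AddCommGroup V] [Module k V]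
variable {R : Type u} [CommRing R]

/-- The action of a matrix `m` on a right `k[M₂(R)]`-module: `act ρ m v = v · m`. -/
def act (ρ : Representation k (M2 R)ᵐᵒᵖ V) (m : M2 R) : V →ₗ[k] V := ρ (MulOpposite.op m)

theorem act_mul (ρ : Representation k (M2 R)ᵐᵒᵖ V) (m n : M2 R) (x : V) :
    act ρ (m * n) x = act ρ n (act ρ m x) := by
  simp [act]

/-- One-cocycles of `Γ` with values in a right module: `c (g h) = c(g) · h + c(h)`. -/
def Z1 (Γ : Subgroup SL(2, R)) (ρ : Representation k (M2 R)ᵐᵒᵖ V) : Submodule k (Γ → V) where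
  carrier := {c | ∀ g h : Γ, c (g * h) = act ρ ((h : SL(2, R)) : M2 R) (c g) + c h}
  add_mem' {a b} ha hb g h := by
    simp only [Pi.add_apply, ha g h, hb g h, map_add]; abel
  zero_mem' g h := by simp
  smul_mem' t a ha g h := by
    simp only [Pi.smul_apply, ha g h, map_smul, smul_add]

/-- The map sending `v` to the one-coboundary `g ↦ v · g - v`. -/
def d0 (Γ : Subgroup SL(2, R)) (ρ : Representation k (M2 R)ᵐᵒᵖ V) : V →ₗ[k] (Γ → V) where
  toFun x g := act ρ ((g : SL(2, R)) : M2 R) x - x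
  map_add' x y := by funext g; simp only [map_add, Pi.add_apply]; abel
  map_smul' t x := by funext g; simp [smul_sub]

/-- One-coboundaries. -/
def B1 (Γ : Subgroup SL(2, R)) (ρ : Representation k (M2 R)ᵐᵒᵖ V) : Submodule k (Γ → V) :=
  LinearMap.range (d0 Γ ρ)

/-- The first cohomology group `H¹(Γ, V)`: one-cocycles modulo one-coboundaries. -/
abbrev H1 (Γ : Subgroup SL(2, R)) (ρ : Representation k (M2 R)ᵐᵒᵖ V) :=
  (Z1 Γ ρ) ⧸ (B1 Γ ρ).submoduleOf (Z1 Γ ρ)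

end Cohomology

section Cosets

variable {R : Type u} [CommRing R]

/-- The double coset `Γ diag(α, 1) Γ`. -/
def heckeDouble (Γ : Subgroup SL(2, R)) (α : R) : Set (M2 R) :=
  {m | ∃ g h : Γ, m = ((g : SL(2, R)) : M2 R) * !![α, 0; 0, 1] * ((h : SL(2, R)) : M2 R)}

/-- Two elements of `Γ diag(α, 1) Γ` are equivalent if they lie in the same left coset `γ Γ`. -/
def heckeSetoid (Γ : Subgroup SL(2, R)) (α : R) : Setoid (heckeDouble Γ α) where
  r m n := ∃ h : Γ, (n : M2 R) = (m : M2 R) * ((h : SL(2, R)) : M2 R)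
  iseqv :=
    { refl := fun m => ⟨1, by simp⟩
      symm := by
        rintro m n ⟨h, e⟩
        refine ⟨h⁻¹, ?_⟩
        rw [e, mul_assoc, ← Matrix.SpecialLinearGroup.coe_mul, ← Subgroup.coe_mul]
        simp
      trans := by
        rintro m n p ⟨h, e⟩ ⟨h', e'⟩
        exact ⟨h * h', by rw [e', e, mul_assoc]; simp⟩ }

/-- The set `Γ diag(α, 1) Γ / Γ` of left cosets. -/
def HeckeCosets (Γ : Subgroup SL(2, R)) (α : R) := Quotient (heckeSetoid Γ α)

/-- Left translation by `g ∈ Γ` on `Γ diag(α, 1) Γ / Γ`. -/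
def translate {Γ : Subgroup SL(2, R)} {α : R} (g : Γ) : HeckeCosets Γ α → HeckeCosets Γ α :=
  Quotient.map'
    (fun m => ⟨((g : SL(2, R)) : M2 R) * m.1, by
      obtain ⟨a, b, e⟩ := m.2
      exact ⟨g * a, b, by rw [e]; simp [mul_assoc]⟩⟩)
    (by
      rintro m n ⟨h, e⟩
      exact ⟨h, by simp only [e, mul_assoc]⟩)

/-- A system of representatives `γ_q` of the cosets `q` in `Γ diag(α, 1) Γ / Γ`. -/
noncomputable def rep {Γ : Subgroup SL(2, R)} {α : R} (q : HeckeCosets Γ α) : M2 R :=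
  (Quotient.out (s := heckeSetoid Γ α) q).1

theorem exists_transfer {Γ : Subgroup SL(2, R)} {α : R} (g : Γ) (q : HeckeCosets Γ α) :
    ∃ h : Γ, ((g : SL(2, R)) : M2 R) * rep q = rep (translate g q) * ((h : SL(2, R)) : M2 R) := by
  have hq : q = Quotient.mk (heckeSetoid Γ α) (Quotient.out (s := heckeSetoid Γ α) q) :=
    (Quotient.out_eq (s := heckeSetoid Γ α) q).symm
  have h1 : Quotient.mk (heckeSetoid Γ α)
      (Quotient.out (s := heckeSetoid Γ α) (translate g q)) = translate g q :=
    Quotient.out_eq (s := heckeSetoid Γ α) _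
  conv_rhs at h1 => rw [hq]
  obtain ⟨h, e⟩ := Quotient.exact h1
  exact ⟨h, e⟩

/-- For `g ∈ Γ` and a coset `q`, with representatives `γ_q` and `γ_{gq}` of `q` and `g q`, the
element `γ_{gq}⁻¹ g γ_q` of `Γ`. -/
noncomputable def transfer {Γ : Subgroup SL(2, R)} {α : R} (g : Γ) (q : HeckeCosets Γ α) : Γ :=
  (exists_transfer g q).choose

theorem transfer_spec {Γ : Subgroup SL(2, R)} {α : R} (g : Γ) (q : HeckeCosets Γ α) :
    ((g : SL(2, R)) : M2 R) * rep q =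
      rep (translate g q) * ((transfer g q : SL(2, R)) : M2 R) :=
  (exists_transfer g q).choose_spec

theorem translate_one {Γ : Subgroup SL(2, R)} {α : R} (q : HeckeCosets Γ α) :
    translate 1 q = q := by
  induction q using Quotient.inductionOn with
  | h m => exact Quotient.sound ⟨1, by simp⟩

theorem translate_mul {Γ : Subgroup SL(2, R)} {α : R} (g h : Γ) (q : HeckeCosets Γ α) :
    translate (g * h) q = translate g (translate h q) := by
  induction q using Quotient.inductionOn with
  | h m => exact Quotient.sound ⟨1, by simp [mul_assoc]⟩

/-- Left translation by an element of `Γ` is a permutation of `Γ diag(α, 1) Γ / Γ`. -/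
def translateEquiv {Γ : Subgroup SL(2, R)} {α : R} (g : Γ) :
    HeckeCosets Γ α ≃ HeckeCosets Γ α where
  toFun := translate g
  invFun := translate g⁻¹
  left_inv q := by rw [← translate_mul, inv_mul_cancel, translate_one]
  right_inv q := by rw [← translate_mul, mul_inv_cancel, translate_one]

theorem det_of_mem {Γ : Subgroup SL(2, R)} {α : R} {m : M2 R} (hm : m ∈ heckeDouble Γ α) :
    m.det = α := by
  obtain ⟨g, h, rfl⟩ := hm
  simp [Matrix.det_mul]

theorem det_rep {Γ : Subgroup SL(2, R)} {α : R} (q : HeckeCosets Γ α) : (rep q).det = α :=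
  det_of_mem (Quotient.out (s := heckeSetoid Γ α) q).2

theorem cancel_left [IsDomain R] {m x y : M2 R} (hm : m.det ≠ 0) (h : m * x = m * y) : x = y := by
  have h2 : m.adjugate * (m * x) = m.adjugate * (m * y) := by rw [h]
  rw [← mul_assoc, ← mul_assoc, Matrix.adjugate_mul, Matrix.smul_mul, Matrix.smul_mul,
    one_mul, one_mul] at h2
  exact smul_right_injective _ hm h2

theorem transfer_mul [IsDomain R] {Γ : Subgroup SL(2, R)} {α : R} (hα : α ≠ 0) (g h : Γ)
    (q : HeckeCosets Γ α) :
    transfer (g * h) q = transfer g (translate h q) * transfer h q := by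
  apply Subtype.ext
  apply Subtype.ext
  apply cancel_left (m := rep (translate (g * h) q)) (by rw [det_rep]; exact hα)
  have e : rep (translate (g * h) q) * (((transfer (g * h) q : Γ) : SL(2, R)) : M2 R) =
      (((g * h : Γ) : SL(2, R)) : M2 R) * rep q := (transfer_spec (g * h) q).symm
  refine e.trans ?_
  have e1 := transfer_spec h q
  have e2 := transfer_spec g (translate h q)
  rw [translate_mul, Subgroup.coe_mul, Subgroup.coe_mul, Matrix.SpecialLinearGroup.coe_mul, mul_assoc,
    e1, ← mul_assoc, e2, mul_assoc]
  exact congrArg _ (Matrix.SpecialLinearGroup.coe_mul _ _).symm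

theorem transfer_adjugate [IsDomain R] {Γ : Subgroup SL(2, R)} {α : R} (hα : α ≠ 0) (g : Γ)
    (q : HeckeCosets Γ α) :
    ((transfer g q : SL(2, R)) : M2 R) * (rep q).adjugate =
      (rep (translate g q)).adjugate * ((g : SL(2, R)) : M2 R) := by
  apply cancel_left (m := rep (translate g q)) (by rw [det_rep]; exact hα)
  rw [← mul_assoc, ← transfer_spec, mul_assoc, Matrix.mul_adjugate, ← mul_assoc,
    Matrix.mul_adjugate, det_rep, det_rep]
  simp

end Cosets

section HeckeOperators

variable {k : Type v} [Field k] {V : Type w} [AddCommGroup V] [Module k V]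
variable {R : Type u} [CommRing R]

/-- The Hecke operator on cochains,
`(T_α c)(g) = ∑_q c(γ_{gq}⁻¹ g γ_q) · γ_q^ι`, where `q` runs over `Γ diag(α, 1) Γ / Γ` with
representatives `γ_q`, and `γ^ι = det(γ) γ⁻¹` is the adjugate matrix. -/
noncomputable def heckeCochain (Γ : Subgroup SL(2, R)) (α : R) [Finite (HeckeCosets Γ α)]
    (ρ : Representation k (M2 R)ᵐᵒᵖ V) : (Γ → V) →ₗ[k] (Γ → V) :=
  letI := Fintype.ofFinite (HeckeCosets Γ α)
  { toFun := fun c g => ∑ q : HeckeCosets Γ α, act ρ (rep q).adjugate (c (transfer g q))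
    map_add' := fun a b => by
      funext g; simp [Finset.sum_add_distrib]
    map_smul' := fun t a => by
      funext g; simp [Finset.smul_sum] }

theorem heckeCochain_mem_Z1 [IsDomain R] (Γ : Subgroup SL(2, R)) {α : R} (hα : α ≠ 0)
    [Finite (HeckeCosets Γ α)] (ρ : Representation k (M2 R)ᵐᵒᵖ V) {c : Γ → V} (hc : c ∈ Z1 Γ ρ) :
    heckeCochain Γ α ρ c ∈ Z1 Γ ρ := by
  let _ := Fintype.ofFinite (HeckeCosets Γ α)
  intro g h
  change ∑ q : HeckeCosets Γ α, act ρ (rep q).adjugate (c (transfer (g * h) q)) =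
    act ρ ((h : SL(2, R)) : M2 R)
      (∑ q : HeckeCosets Γ α, act ρ (rep q).adjugate (c (transfer g q))) +
    ∑ q : HeckeCosets Γ α, act ρ (rep q).adjugate (c (transfer h q))
  rw [map_sum, ← Equiv.sum_comp (translateEquiv h)
    (fun q => act ρ ((h : SL(2, R)) : M2 R) (act ρ (rep q).adjugate (c (transfer g q)))),
    ← Finset.sum_add_distrib]
  refine Finset.sum_congr rfl fun q _ => ?_
  rw [transfer_mul hα, hc, map_add, ← act_mul, transfer_adjugate hα, act_mul]
  rfl

theorem heckeCochain_mem_B1 [IsDomain R] (Γ : Subgroup SL(2, R)) {α : R} (hα : α ≠ 0)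
    [Finite (HeckeCosets Γ α)] (ρ : Representation k (M2 R)ᵐᵒᵖ V) {c : Γ → V} (hc : c ∈ B1 Γ ρ) :
    heckeCochain Γ α ρ c ∈ B1 Γ ρ := by
  let _ := Fintype.ofFinite (HeckeCosets Γ α)
  obtain ⟨x, rfl⟩ := hc
  refine ⟨∑ q : HeckeCosets Γ α, act ρ (rep q).adjugate x, ?_⟩
  funext g
  change act ρ ((g : SL(2, R)) : M2 R) (∑ q : HeckeCosets Γ α, act ρ (rep q).adjugate x) -
      ∑ q : HeckeCosets Γ α, act ρ (rep q).adjugate x =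
    ∑ q : HeckeCosets Γ α, act ρ (rep q).adjugate
      (act ρ ((transfer g q : SL(2, R)) : M2 R) x - x)
  rw [map_sum, ← Equiv.sum_comp (translateEquiv g)
    (fun q => act ρ ((g : SL(2, R)) : M2 R) (act ρ (rep q).adjugate x)),
    ← Finset.sum_sub_distrib]
  refine Finset.sum_congr rfl fun q _ => ?_
  rw [map_sub, ← act_mul, ← act_mul, transfer_adjugate hα]
  rfl

/-- The Hecke operator `T_α` on `H¹(Γ, V)`. -/
noncomputable def heckeOp [IsDomain R] (Γ : Subgroup SL(2, R)) (α : R) (hα : α ≠ 0)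
    [Finite (HeckeCosets Γ α)] (ρ : Representation k (M2 R)ᵐᵒᵖ V) :
    Module.End k (H1 Γ ρ) :=
  Submodule.mapQ _ _
    ((heckeCochain Γ α ρ).restrict fun _ hc => heckeCochain_mem_Z1 Γ hα ρ hc)
    (fun _ hc => heckeCochain_mem_B1 Γ hα ρ hc)

end HeckeOperators

section Level

variable {R : Type u} [CommRing R]

/-- The congruence subgroup `Γ₁(𝔟)` of `SL₂(R)`: lower row congruent to `(0, 1)` mod `𝔟`. -/
def Gamma1 (𝔟 : Ideal R) : Subgroup SL(2, R) where
  carrier := {g | g.1 1 0 ∈ 𝔟 ∧ g.1 1 1 - 1 ∈ 𝔟}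
  one_mem' := by simp
  mul_mem' {g h} hg hh := by
    simp only [Set.mem_ofPred_eq, Matrix.SpecialLinearGroup.coe_mul, Matrix.mul_apply,
      Fin.sum_univ_two] at *
    refine ⟨𝔟.add_mem (𝔟.mul_mem_right _ hg.1) (𝔟.mul_mem_left _ hh.1), ?_⟩
    have e : g.1 1 0 * h.1 0 1 + g.1 1 1 * h.1 1 1 - 1 =
      g.1 1 0 * h.1 0 1 + (g.1 1 1 * (h.1 1 1 - 1) + (g.1 1 1 - 1)) := by ring
    rw [e]
    exact 𝔟.add_mem (𝔟.mul_mem_right _ hg.1) (𝔟.add_mem (𝔟.mul_mem_left _ hh.2) hg.2)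
  inv_mem' {g} hg := by
    have hdet := g.2
    rw [Matrix.det_fin_two] at hdet
    simp only [Set.mem_ofPred_eq, Matrix.SpecialLinearGroup.coe_inv, Matrix.adjugate_fin_two] at *
    refine ⟨by simpa using hg.1, ?_⟩
    have e : g.1 0 0 - 1 = g.1 0 1 * g.1 1 0 - g.1 0 0 * (g.1 1 1 - 1) := by
      linear_combination hdet
    have : g.1 0 0 - 1 ∈ 𝔟 := by
      rw [e]; exact 𝔟.sub_mem (𝔟.mul_mem_left _ hg.1) (𝔟.mul_mem_left _ hg.2)
    simpa using this

/-- The reduction of `m` mod `α 𝔟` determines the coset `m Γ₁(𝔟)` in `Γ₁(𝔟) diag(α, 1) Γ₁(𝔟)`. -/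
theorem finite_heckeCosets [IsDomain R] (𝔟 : Ideal R) (α : R) (hα : α ≠ 0)
    [Finite (R ⧸ (Ideal.span {α} * 𝔟))] : Finite (HeckeCosets (Gamma1 𝔟) α) := by
  let f : HeckeCosets (Gamma1 𝔟) α → M2 (R ⧸ (Ideal.span {α} * 𝔟)) :=
    fun q => (Ideal.Quotient.mk _).mapMatrix (rep q)
  refine Finite.of_injective f ?_
  intro p q hpq
  have hent : ∀ i j, ∃ z ∈ 𝔟, α * z = rep q i j - rep p i j := by
    intro i j
    have h1 : Ideal.Quotient.mk (Ideal.span {α} * 𝔟) (rep p i j) =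
        Ideal.Quotient.mk (Ideal.span {α} * 𝔟) (rep q i j) := congrFun (congrFun hpq i) j
    have h2 := Ideal.Quotient.eq.1 h1.symm
    exact Ideal.mem_span_singleton_mul.1 h2
  choose z hz hzz using hent
  let Z : M2 R := Matrix.of z
  let h : M2 R := 1 + (rep p).adjugate * Z
  have hq : rep q = rep p + α • Z := by
    ext i j
    simp only [Matrix.add_apply, Matrix.smul_apply, smul_eq_mul, Z, Matrix.of_apply, hzz]
    ring
  have hmul : rep q = rep p * h := by
    rw [hq, mul_add, mul_one, ← mul_assoc, Matrix.mul_adjugate, det_rep]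
    simp
  have hdet : h.det = 1 := by
    have := congrArg Matrix.det hmul
    rw [Matrix.det_mul, det_rep, det_rep] at this
    exact (mul_left_cancel₀ hα (by rw [mul_one]; exact this)).symm
  have hmem : ∀ i j, ((rep p).adjugate * Z) i j ∈ 𝔟 := by
    intro i j
    rw [Matrix.mul_apply]
    exact 𝔟.sum_mem fun l _ => 𝔟.mul_mem_left _ (hz l j)
  have hG : (⟨h, hdet⟩ : SL(2, R)) ∈ Gamma1 𝔟 := by
    refine ⟨?_, ?_⟩
    · simpa [h] using hmem 1 0
    · simpa [h] using hmem 1 1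
  have hp := Quotient.out_eq (s := heckeSetoid (Gamma1 𝔟) α) p
  have hq' := Quotient.out_eq (s := heckeSetoid (Gamma1 𝔟) α) q
  rw [← hp, ← hq']
  exact Quotient.sound ⟨⟨⟨h, hdet⟩, hG⟩, hmul⟩

end Level

section Systems

/-- The prime elements of `R` that do not divide `n`. -/
def primesNotDividing {R : Type u} [CommRing R] (n : R) : Set {π : R // Prime π} :=
  {π | ¬ π.1 ∣ n}

/-- All prime elements of `R`. -/
def allPrimes (R : Type u) [CommRing R] : Set {π : R // Prime π} := Set.univ

variable {K : Type u} [Field K] [NumberField K]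
variable {k : Type v} [Field k] {V : Type w} [AddCommGroup V] [Module k V]

theorem finite_heckeCosets_Gamma1 {𝔞 : Ideal (𝓞 K)} (h𝔞 : 𝔞 ≠ ⊥) {α : 𝓞 K} (hα : α ≠ 0) :
    Finite (HeckeCosets (Gamma1 𝔞) α) := by
  have : Finite (𝓞 K ⧸ (Ideal.span {α} * 𝔞)) :=
    Ideal.finiteQuotientOfFreeOfNeBot _ (by simp [h𝔞, hα])
  exact finite_heckeCosets 𝔞 α hα

/-- The Hecke operator `T_π` on `H¹(Γ₁(𝔞), V)`, for a prime element `π` of the ring of integers. -/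
noncomputable def heckeT (𝔞 : Ideal (𝓞 K)) (h𝔞 : 𝔞 ≠ ⊥)
    (ρ : Representation k (M2 (𝓞 K))ᵐᵒᵖ V) (π : {π : 𝓞 K // Prime π}) :
    Module.End k (H1 (Gamma1 𝔞) ρ) :=
  haveI := finite_heckeCosets_Gamma1 h𝔞 π.2.ne_zero
  heckeOp (Gamma1 𝔞) π.1 π.2.ne_zero ρ

/-- The Hecke algebra acting on `H¹(Γ₁(𝔞), V)` generated by the `T_π` with `π ∈ S`. -/
noncomputable def heckeAlgebra (𝔞 : Ideal (𝓞 K)) (h𝔞 : 𝔞 ≠ ⊥) (S : Set {π : 𝓞 K // Prime π})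
    (ρ : Representation k (M2 (𝓞 K))ᵐᵒᵖ V) : Subalgebra k (Module.End k (H1 (Gamma1 𝔞) ρ)) :=
  Algebra.adjoin k (heckeT 𝔞 h𝔞 ρ '' S)

/-- The eigenvalue system `Φ` of the Hecke algebra occurs in `H¹(Γ₁(𝔞), V)`. -/
def Occurs {𝔞 : Ideal (𝓞 K)} {h𝔞 : 𝔞 ≠ ⊥} {S : Set {π : 𝓞 K // Prime π}}
    {ρ : Representation k (M2 (𝓞 K))ᵐᵒᵖ V} (Φ : heckeAlgebra 𝔞 h𝔞 S ρ →+* k) : Prop :=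
  ∃ a : H1 (Gamma1 𝔞) ρ, a ≠ 0 ∧
    ∀ T : heckeAlgebra 𝔞 h𝔞 S ρ, (T : Module.End k (H1 (Gamma1 𝔞) ρ)) a = Φ T • a

/-- The family of scalars `(φ_π)`, `π ∈ S`, is a system of Hecke eigenvalues occurring in
`H¹(Γ₁(𝔞), V)`: some eigenvalue system `Φ` occurring there has `Φ(T_π) = φ_π` for all `π ∈ S`.
(As the `T_π` generate the Hecke algebra, an occurring `Φ` is determined by `(φ_π)`; the family
allows systems occurring in different modules to be compared.) -/
def IsHeckeEigensystem (𝔞 : Ideal (𝓞 K)) (h𝔞 : 𝔞 ≠ ⊥) (S : Set {π : 𝓞 K // Prime π})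
    (ρ : Representation k (M2 (𝓞 K))ᵐᵒᵖ V) (φ : S → k) : Prop :=
  ∃ Φ : heckeAlgebra 𝔞 h𝔞 S ρ →+* k, Occurs Φ ∧
    ∀ π : S, Φ ⟨heckeT 𝔞 h𝔞 ρ π, Algebra.subset_adjoin ⟨π, π.2, rfl⟩⟩ = φ π

end Systems

end BianchiHecke

/-! Two finiteness facts carry the proof: $\Gamma_1(\mathfrak a)$ is finitely generated, and the
finite monoid $\mathrm M_2(\mathcal O/\ell)$ has only finitely many simple modules over $k$. The
first makes $H^1(\Gamma_1(\mathfrak a),E)$ finite-dimensional for finite-dimensional $E$, and the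
second reduces arbitrary $E$ to finitely many.

The reduction follows composition series through the exact sequence $H^1(E')\to H^1(E)\to H^1(E'')$.
The left map need not be injective, so an eigenvector that dies on the right need not lift to an
eigenvector. Eigenvectors are therefore replaced by `charSupport`, the characters of the free
algebra that vanish on every element acting as zero. This set contains all eigensystems, is
subadditive in exact sequences (`charSupport_subset_union`) and is finite on finite-dimensional
spaces (`charSupport_finite`). Neither commuting operators nor an algebraically closed field is
needed. Every simple module is a quotient of the regular module, and dévissage of that one module
bounds all simple modules at once (`simpleTargetSupport_finite`).

Finite generation comes from reduction theory: $\mathrm{SL}_2(\mathcal O)$ acts on the convex, hence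
connected, cone of positive definite Hermitian forms. Class number one lets an open set of nearly
reduced forms meet every orbit (`exists_reduced_form`), and only finitely many group elements move
this set to meet itself (`entries_bound`). These elements generate the group. -/

namespace BianchiHecke

universe u v w

/-! ### Characters supported on a module over a free algebra -/

section CharSupport

variable {k S W W' W'' : Type*} [Field k] [AddCommGroup W] [Module k W]
  [AddCommGroup W'] [Module k W'] [AddCommGroup W''] [Module k W'']

/-- The families of scalars which, as characters of the free algebra on `S`, factor through the
algebra of endomorphisms of `W` generated by the `T s`. -/
def charSupport (T : S → Module.End k W) : Set (S → k) :=
  {φ | ∀ f : FreeAlgebra k S, FreeAlgebra.lift k T f = 0 → FreeAlgebra.lift k φ f = 0}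

theorem lift_intertwine {T : S → Module.End k W} {T' : S → Module.End k W'} (i : W' →ₗ[k] W)
    (hi : ∀ s x, i (T' s x) = T s (i x)) (f : FreeAlgebra k S) :
    ∀ x, i (FreeAlgebra.lift k T' f x) = FreeAlgebra.lift k T f (i x) := by
  induction f using FreeAlgebra.induction with
  | grade0 r => intro x; simp [Module.algebraMap_end_apply]
  | grade1 s => intro x; simp [hi]
  | mul a b ha hb => intro x; simp [ha, hb]
  | add a b ha hb => intro x; simp [ha, hb]

/-- If `φ` is in neither set on the right, some `f'` kills `W'` and some `f''` kills `W''` while `φ`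
vanishes on neither. Then `f''` maps `W` into the image of `W'`, so `f' * f''` kills `W`, but `φ` is
non-zero on it. -/
theorem charSupport_subset_union {T : S → Module.End k W} {T' : S → Module.End k W'}
    {T'' : S → Module.End k W''} (i : W' →ₗ[k] W) (p : W →ₗ[k] W'')
    (hi : ∀ s x, i (T' s x) = T s (i x)) (hp : ∀ s x, p (T s x) = T'' s (p x))
    (hexact : ∀ x, p x = 0 → ∃ y, i y = x) :
    charSupport T ⊆ charSupport T' ∪ charSupport T'' := by
  intro φ hφ
  by_contra hcon
  simp only [charSupport, Set.mem_union, Set.mem_ofPred_eq, not_or, not_forall] at hcon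
  obtain ⟨⟨f', hf', hne'⟩, ⟨f'', hf'', hne''⟩⟩ := hcon
  have h0 : FreeAlgebra.lift k φ (f' * f'') = 0 := by
    refine hφ _ ?_
    ext x
    obtain ⟨y, hy⟩ := hexact (FreeAlgebra.lift k T f'' x) (by
      rw [lift_intertwine p hp, hf'']; rfl)
    rw [map_mul, Module.End.mul_apply, ← hy, ← lift_intertwine i hi, hf']
    simp
  rw [map_mul] at h0
  exact (mul_ne_zero hne' hne'') h0

theorem charSupport_eq_empty_of_subsingleton [Subsingleton W] (T : S → Module.End k W) :
    charSupport T = ∅ := by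
  refine Set.eq_empty_of_forall_notMem fun φ hφ => ?_
  have := hφ 1 (Subsingleton.elim _ _)
  simp at this

theorem mem_charSupport_of_eigenvector {T : S → Module.End k W} {φ : S → k} {a : W} (ha : a ≠ 0)
    (h : ∀ s, T s a = φ s • a) : φ ∈ charSupport T := by
  have key : ∀ f : FreeAlgebra k S, FreeAlgebra.lift k T f a = FreeAlgebra.lift k φ f • a := by
    intro f
    induction f using FreeAlgebra.induction with
    | grade0 r => simp [Module.algebraMap_end_apply]
    | grade1 s => simp [h]
    | mul x y hx hy => simp only [map_mul, Module.End.mul_apply, hx, hy, map_smul, smul_smul, mul_comm]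
    | add x y hx hy => simp [hx, hy, add_smul]
  intro f hf
  have := key f
  rw [hf] at this
  exact (smul_eq_zero.1 this.symm).resolve_right ha

/-- Dedekind: distinct characters are linearly independent, and here they all lie in the dual of one
finite-dimensional quotient of the free algebra. -/
theorem charSupport_finite [FiniteDimensional k W] (T : S → Module.End k W) :
    (charSupport T).Finite := by
  let N : Submodule k (FreeAlgebra k S) := LinearMap.ker (FreeAlgebra.lift k T).toLinearMap
  have : FiniteDimensional k (FreeAlgebra k S ⧸ N) :=
    LinearEquiv.finiteDimensional
      (FreeAlgebra.lift k T).toLinearMap.quotKerEquivRange.symm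
  let F : charSupport T → Module.Dual k (FreeAlgebra k S ⧸ N) := fun φ =>
    N.liftQ (FreeAlgebra.lift k φ.1).toLinearMap fun f hf => φ.2 f hf
  let J : Module.Dual k (FreeAlgebra k S ⧸ N) →ₗ[k] (FreeAlgebra k S → k) :=
    { toFun := fun d f => d (N.mkQ f)
      map_add' := fun _ _ => rfl
      map_smul' := fun _ _ => rfl }
  let M : charSupport T → (FreeAlgebra k S →* k) := fun φ =>
    ((FreeAlgebra.lift k φ.1 : FreeAlgebra k S →ₐ[k] k) : FreeAlgebra k S →* k)
  have hM : Function.Injective M := by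
    intro φ ψ h
    ext s
    have := DFunLike.congr_fun h (FreeAlgebra.ι k s)
    simpa [M] using this
  have hli : LinearIndependent k F := by
    refine LinearIndependent.of_comp J ?_
    exact (linearIndependent_monoidHom (FreeAlgebra k S) k).comp M hM
  have : Finite (charSupport T) := hli.finite
  exact Set.toFinite _

end CharSupport

/-! ### Functoriality of $H^1$ and Hecke equivariance -/

section Functoriality

variable {k : Type*} [Field k] {V V' V'' : Type*} [AddCommGroup V] [Module k V]
  [AddCommGroup V'] [Module k V'] [AddCommGroup V''] [Module k V'']
variable {R : Type u} [CommRing R] {Γ : Subgroup SL(2, R)}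
variable {ρ : Representation k (M2 R)ᵐᵒᵖ V} {ρ' : Representation k (M2 R)ᵐᵒᵖ V'}
  {ρ'' : Representation k (M2 R)ᵐᵒᵖ V''}

/-- The map on one-cocycles induced by an equivariant map. -/
def mapZ1 (Γ : Subgroup SL(2, R)) (θ : V →ₗ[k] V') (hθ : ∀ m x, θ (act ρ m x) = act ρ' m (θ x)) :
    Z1 Γ ρ →ₗ[k] Z1 Γ ρ' :=
  (θ.compLeft Γ).restrict fun c hc g h => by
    change θ (c (g * h)) = act ρ' _ (θ (c g)) + θ (c h)
    rw [hc g h, map_add, hθ]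

/-- The map on `H¹` induced by an equivariant map. -/
def mapH1 (Γ : Subgroup SL(2, R)) (θ : V →ₗ[k] V') (hθ : ∀ m x, θ (act ρ m x) = act ρ' m (θ x)) :
    H1 Γ ρ →ₗ[k] H1 Γ ρ' :=
  Submodule.mapQ _ _ (mapZ1 Γ θ hθ) (by
    rintro c ⟨x, hx⟩
    refine ⟨θ x, ?_⟩
    funext g
    have := congrFun hx g
    change act ρ' _ (θ x) - θ x = θ (c.1 g)
    rw [← hθ, ← map_sub]
    exact congrArg θ this)

theorem mapH1_heckeOp [IsDomain R] (θ : V →ₗ[k] V')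
    (hθ : ∀ m x, θ (act ρ m x) = act ρ' m (θ x)) {α : R} (hα : α ≠ 0)
    [Finite (HeckeCosets Γ α)] (x : H1 Γ ρ) :
    mapH1 Γ θ hθ (heckeOp Γ α hα ρ x) = heckeOp Γ α hα ρ' (mapH1 Γ θ hθ x) := by
  induction x using Submodule.Quotient.induction_on with
  | _ c =>
    change Submodule.Quotient.mk _ = Submodule.Quotient.mk _
    congr 1
    apply Subtype.ext
    funext g
    let _ := Fintype.ofFinite (HeckeCosets Γ α)
    change θ (∑ q : HeckeCosets Γ α, act ρ (rep q).adjugate (c.1 (transfer g q))) =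
      ∑ q : HeckeCosets Γ α, act ρ' (rep q).adjugate (θ (c.1 (transfer g q)))
    rw [map_sum]
    exact Finset.sum_congr rfl fun q _ => hθ _ _

theorem mapH1_exact (i : V' →ₗ[k] V) (hi : ∀ m x, i (act ρ' m x) = act ρ m (i x))
    (p : V →ₗ[k] V'') (hp : ∀ m x, p (act ρ m x) = act ρ'' m (p x))
    (hinj : Function.Injective i) (hsurj : Function.Surjective p)
    (hex : ∀ x, p x = 0 ↔ ∃ y, i y = x) (x : H1 Γ ρ) (hx : mapH1 Γ p hp x = 0) :
    ∃ y, mapH1 Γ i hi y = x := by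
  induction x using Submodule.Quotient.induction_on with
  | _ c =>
    have hx' : (mapZ1 Γ p hp c) ∈ (B1 Γ ρ'').submoduleOf (Z1 Γ ρ'') :=
      (Submodule.Quotient.mk_eq_zero _).1 hx
    obtain ⟨z'', hz''⟩ := hx'
    obtain ⟨z, rfl⟩ := hsurj z''
    -- Subtracting the coboundary of a lift `z` makes the cocycle vanish in `V''`, so it takes
    -- values in the image of `V'`.
    have hker : ∀ g : Γ, ∃ y, i y = c.1 g - (act ρ ((g : SL(2, R)) : M2 R) z - z) := by
      intro g
      rw [← hex, map_sub, map_sub, hp, sub_eq_zero]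
      exact (congrFun hz'' g).symm
    choose c' hc' using hker
    have hc'Z : c' ∈ Z1 Γ ρ' := by
      intro g h
      apply hinj
      rw [map_add, hi, hc', hc', hc', c.2 g h, map_sub, map_sub, ← act_mul]
      simp only [Subgroup.coe_mul, Matrix.SpecialLinearGroup.coe_mul]
      abel
    refine ⟨Submodule.Quotient.mk ⟨c', hc'Z⟩, ?_⟩
    change Submodule.Quotient.mk _ = Submodule.Quotient.mk _
    rw [Submodule.Quotient.eq]
    refine ⟨-z, ?_⟩
    funext g
    change act ρ _ (-z) - -z = i (c' g) - c.1 g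
    rw [hc', map_neg]
    abel

end Functoriality

/-! ### Finite-dimensionality of $H^1$ -/

section FiniteDimensionality

variable {k : Type*} [Field k] {V : Type*} [AddCommGroup V] [Module k V]
variable {R : Type u} [CommRing R] {Γ : Subgroup SL(2, R)} {ρ : Representation k (M2 R)ᵐᵒᵖ V}

theorem cocycle_one {c : Γ → V} (hc : c ∈ Z1 Γ ρ) : c 1 = 0 := by
  have := hc 1 1
  simpa [act] using this

/-- A cocycle is determined by its values on a finite generating set. -/
theorem finiteDimensional_H1 [Group.FG Γ] [FiniteDimensional k V] :
    FiniteDimensional k (H1 Γ ρ) := by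
  obtain ⟨s, hs⟩ := Group.FG.out (G := Γ)
  let r : Z1 Γ ρ →ₗ[k] (s → V) :=
    { toFun := fun c g => c.1 g
      map_add' := fun _ _ => rfl
      map_smul' := fun _ _ => rfl }
  have hr : Function.Injective r := by
    rw [injective_iff_map_eq_zero]
    intro c hc
    apply Subtype.ext
    funext g
    change c.1 g = 0
    have hg : g ∈ Subgroup.closure (s : Set Γ) := by rw [hs]; trivial
    induction hg using Subgroup.closure_induction with
    | mem x hx => exact congrFun hc ⟨x, hx⟩
    | one => exact cocycle_one c.2
    | mul x y _ _ hx hy => rw [c.2 x y, hx, hy]; simp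
    | inv x _ hx =>
      have := c.2 x x⁻¹
      rw [mul_inv_cancel, cocycle_one c.2, hx] at this
      simpa using this.symm
  have : FiniteDimensional k (Z1 Γ ρ) := FiniteDimensional.of_injective r hr
  infer_instance

end FiniteDimensionality

/-! ### Dévissage to simple modules -/

section Devissage

/-- A representation without invariant subspaces other than `⊥` and `⊤`. -/
def HasNoProperInvariant {k G V : Type*} [Field k] [Monoid G] [AddCommGroup V] [Module k V]
    (ρ : Representation k G V) : Prop :=
  ∀ N : Submodule k V, (∀ g, N ≤ N.comap (ρ g)) → N = ⊥ ∨ N = ⊤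

/-- The left regular representation of a monoid. -/
noncomputable def regularRep (k G : Type*) [Field k] [Monoid G] : Representation k G (G →₀ k) where
  toFun g := Finsupp.lmapDomain k k (g * ·)
  map_one' := by ext; simp
  map_mul' g h := by ext; simp [mul_assoc]

variable {K : Type*} [Field K] [NumberField K] (𝔞 : Ideal (𝓞 K)) (h𝔞 : 𝔞 ≠ ⊥)
  (S : Set {π : 𝓞 K // Prime π}) (I : Ideal (𝓞 K))
variable {k : Type*} [Field k]

/-- The families `(φ_π)`, `π ∈ S`, which factor through the Hecke algebra of `H¹(Γ₁(𝔞), E)`. -/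
def heckeSupport {E : Type*} [AddCommGroup E] [Module k E]
    (ρ : Representation k (M2 (𝓞 K ⧸ I))ᵐᵒᵖ E) : Set (S → k) :=
  charSupport fun π : S => heckeT 𝔞 h𝔞 (inflate I ρ) π

variable {E E' E'' : Type*} [AddCommGroup E] [Module k E] [AddCommGroup E'] [Module k E']
  [AddCommGroup E''] [Module k E'']
  {ρ : Representation k (M2 (𝓞 K ⧸ I))ᵐᵒᵖ E} {ρ' : Representation k (M2 (𝓞 K ⧸ I))ᵐᵒᵖ E'}
  {ρ'' : Representation k (M2 (𝓞 K ⧸ I))ᵐᵒᵖ E''}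

theorem heckeSupport_subset_union (i : E' →ₗ[k] E) (hi : ∀ m x, i (ρ' m x) = ρ m (i x))
    (p : E →ₗ[k] E'') (hp : ∀ m x, p (ρ m x) = ρ'' m (p x))
    (hinj : Function.Injective i) (hsurj : Function.Surjective p)
    (hex : ∀ x, p x = 0 ↔ ∃ y, i y = x) :
    heckeSupport 𝔞 h𝔞 S I ρ ⊆ heckeSupport 𝔞 h𝔞 S I ρ' ∪ heckeSupport 𝔞 h𝔞 S I ρ'' := by
  have hi' : ∀ m x, i (act (inflate I ρ') m x) = act (inflate I ρ) m (i x) := fun m x => hi _ x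
  have hp' : ∀ m x, p (act (inflate I ρ) m x) = act (inflate I ρ'') m (p x) := fun m x => hp _ x
  refine charSupport_subset_union (mapH1 _ i hi') (mapH1 _ p hp') ?_ ?_ ?_
  · intro π x
    have := finite_heckeCosets_Gamma1 h𝔞 π.1.2.ne_zero
    exact mapH1_heckeOp i hi' π.1.2.ne_zero x
  · intro π x
    have := finite_heckeCosets_Gamma1 h𝔞 π.1.2.ne_zero
    exact mapH1_heckeOp p hp' π.1.2.ne_zero x
  · exact fun x hx => mapH1_exact i hi' p hp' hinj hsurj hex x hx

theorem heckeSupport_subset_sub_quotient (N : Submodule k E) (hN : ∀ g, N ≤ N.comap (ρ g)) :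
    heckeSupport 𝔞 h𝔞 S I ρ ⊆ heckeSupport 𝔞 h𝔞 S I (ρ.subrepresentation N hN) ∪
      heckeSupport 𝔞 h𝔞 S I (ρ.quotient N hN) := by
  refine heckeSupport_subset_union 𝔞 h𝔞 S I N.subtype (fun _ _ => rfl) N.mkQ (fun _ _ => rfl)
    N.injective_subtype N.mkQ_surjective fun x => ?_
  rw [Submodule.mkQ_apply, Submodule.Quotient.mk_eq_zero]
  simp

theorem heckeSupport_eq_empty [Subsingleton E] : heckeSupport 𝔞 h𝔞 S I ρ = ∅ := by
  have : Subsingleton (H1 (Gamma1 𝔞) (inflate I ρ)) :=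
    (Submodule.mkQ_surjective _).subsingleton
  exact charSupport_eq_empty_of_subsingleton _

theorem heckeSupport_subset_of_bijective (p : E →ₗ[k] E'') (hp : ∀ m x, p (ρ m x) = ρ'' m (p x))
    (hbij : Function.Bijective p) :
    heckeSupport 𝔞 h𝔞 S I ρ ⊆ heckeSupport 𝔞 h𝔞 S I ρ'' := by
  have h := heckeSupport_subset_union 𝔞 h𝔞 S I (ρ' := ρ.subrepresentation ⊥ (fun g => bot_le))
    (Submodule.subtype ⊥) (fun _ _ => rfl) p hp (Submodule.injective_subtype _) hbij.2 fun x => by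
      rw [map_eq_zero_iff p hbij.1]; simp [eq_comm]
  intro φ hφ
  rcases h hφ with h | h
  · exact ((heckeSupport_eq_empty 𝔞 h𝔞 S I).subset h).elim
  · exact h

theorem exists_simple_of_mem_heckeSupport {φ : S → k} (n : ℕ) :
    ∀ {E : Type w} [AddCommGroup E] [Module k E] [FiniteDimensional k E]
      (ρ : Representation k (M2 (𝓞 K ⧸ I))ᵐᵒᵖ E), Module.finrank k E = n →
      φ ∈ heckeSupport 𝔞 h𝔞 S I ρ →
      ∃ (E₀ : Type w) (_ : AddCommGroup E₀) (_ : Module k E₀) (_ : Nontrivial E₀)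
        (ρ₀ : Representation k (M2 (𝓞 K ⧸ I))ᵐᵒᵖ E₀),
        HasNoProperInvariant ρ₀ ∧ φ ∈ heckeSupport 𝔞 h𝔞 S I ρ₀ := by
  induction n using Nat.strong_induction_on with
  | _ n ih =>
    intro E _ _ _ ρ hn hφ
    by_cases hs : HasNoProperInvariant ρ
    · rcases subsingleton_or_nontrivial E with h | h
      · rw [heckeSupport_eq_empty] at hφ
        exact hφ.elim
      · exact ⟨E, _, _, h, ρ, hs, hφ⟩
    · simp only [HasNoProperInvariant, not_forall, not_or] at hs
      obtain ⟨N, hN, hbot, htop⟩ := hs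
      have h1 := Submodule.finrank_lt htop
      have h2 := N.finrank_quotient_add_finrank
      have h3 : 0 < Module.finrank k N :=
        Nat.pos_of_ne_zero fun h => hbot (Submodule.finrank_eq_zero.1 h)
      rcases heckeSupport_subset_sub_quotient 𝔞 h𝔞 S I N hN hφ with h | h
      · exact ih _ (by omega) _ rfl h
      · exact ih _ (by omega) _ rfl h

/-- The families that factor through the Hecke algebra of a simple module to which `ρ` maps. -/
def simpleTargetSupport (ρ : Representation k (M2 (𝓞 K ⧸ I))ᵐᵒᵖ E) : Set (S → k) :=
  {φ | ∃ (E₀ : Type w) (_ : AddCommGroup E₀) (_ : Module k E₀)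
    (ρ₀ : Representation k (M2 (𝓞 K ⧸ I))ᵐᵒᵖ E₀) (θ : E →ₗ[k] E₀),
    (∀ m x, θ (ρ m x) = ρ₀ m (θ x)) ∧ θ ≠ 0 ∧ HasNoProperInvariant ρ₀ ∧
      φ ∈ heckeSupport 𝔞 h𝔞 S I ρ₀}

/-- A non-zero map to a simple module is either non-zero on an invariant subspace `N` or factors
through the quotient by `N`, which gives an induction on dimension. If `E` itself has no proper
invariant subspace, Schur's lemma makes every target isomorphic to `E`, and a single finite
`charSupport` remains. The targets have their own universe, as the regular module need not live in
that of the modules `E` of the theorem. -/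
theorem simpleTargetSupport_finite (hfg : Group.FG (Gamma1 𝔞)) (n : ℕ) :
    ∀ {E : Type v} [AddCommGroup E] [Module k E] [FiniteDimensional k E]
      (ρ : Representation k (M2 (𝓞 K ⧸ I))ᵐᵒᵖ E), Module.finrank k E = n →
      (simpleTargetSupport.{w} 𝔞 h𝔞 S I ρ).Finite := by
  induction n using Nat.strong_induction_on with
  | _ n ih =>
    intro E _ _ _ ρ hn
    by_cases hs : HasNoProperInvariant ρ
    · have hfd := finiteDimensional_H1 (Γ := Gamma1 𝔞) (ρ := inflate I ρ)
      refine (charSupport_finite fun π : S => heckeT 𝔞 h𝔞 (inflate I ρ) π).subset ?_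
      rintro φ ⟨E₀, _, _, ρ₀, θ, hθ, hne, hs₀, hφ⟩
      have hker : LinearMap.ker θ = ⊥ := by
        refine (hs _ fun g x hx => ?_).resolve_right fun h => hne (LinearMap.ker_eq_top.1 h)
        simp only [Submodule.mem_comap, LinearMap.mem_ker] at hx ⊢
        rw [hθ, hx, map_zero]
      have hran : LinearMap.range θ = ⊤ := by
        refine (hs₀ _ ?_).resolve_left fun h => hne (LinearMap.range_eq_bot.1 h)
        rintro g _ ⟨x, rfl⟩
        exact ⟨ρ g x, hθ g x⟩
      let e := LinearEquiv.ofBijective θ ⟨LinearMap.ker_eq_bot.1 hker, LinearMap.range_eq_top.1 hran⟩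
      refine heckeSupport_subset_of_bijective 𝔞 h𝔞 S I e.symm.toLinearMap (fun m x => ?_)
        e.symm.bijective hφ
      obtain ⟨y, rfl⟩ := e.surjective x
      change e.symm (ρ₀ m (θ y)) = ρ m (e.symm (e y))
      rw [← hθ, e.symm_apply_apply]
      exact e.symm_apply_apply _
    · simp only [HasNoProperInvariant, not_forall, not_or] at hs
      obtain ⟨N, hN, hbot, htop⟩ := hs
      have h1 := Submodule.finrank_lt htop
      have h2 := N.finrank_quotient_add_finrank
      have h3 : 0 < Module.finrank k N :=
        Nat.pos_of_ne_zero fun h => hbot (Submodule.finrank_eq_zero.1 h)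
      refine ((ih _ (by omega) (ρ.subrepresentation N hN) rfl).union
        (ih _ (by omega) (ρ.quotient N hN) rfl)).subset ?_
      rintro φ ⟨E₀, _, _, ρ₀, θ, hθ, hne, hs₀, hφ⟩
      by_cases hz : θ ∘ₗ N.subtype = 0
      · have hle : N ≤ LinearMap.ker θ := fun x hx => LinearMap.congr_fun hz ⟨x, hx⟩
        refine Or.inr ⟨E₀, _, _, ρ₀, N.liftQ θ hle, ?_, ?_, hs₀, hφ⟩
        · intro m x
          induction x using Submodule.Quotient.induction_on with
          | _ x => exact hθ m x
        · intro h
          apply hne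
          ext x
          exact LinearMap.congr_fun h (N.mkQ x)
      · exact Or.inl ⟨E₀, _, _, ρ₀, θ ∘ₗ N.subtype, fun m x => hθ m x, hz, hs₀, hφ⟩

theorem finite_setOf_isHeckeEigensystem (hfg : Group.FG (Gamma1 𝔞)) [Finite (𝓞 K ⧸ I)] :
    {φ : S → k | ∃ (E : Type w) (_ : AddCommGroup E) (_ : Module k E) (_ : FiniteDimensional k E)
        (ρ : Representation k (M2 (𝓞 K ⧸ I))ᵐᵒᵖ E),
        IsHeckeEigensystem 𝔞 h𝔞 S (inflate I ρ) φ}.Finite := by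
  have : Finite (M2 (𝓞 K ⧸ I)) := inferInstanceAs (Finite (Fin 2 → Fin 2 → 𝓞 K ⧸ I))
  have : Finite (M2 (𝓞 K ⧸ I))ᵐᵒᵖ := Finite.of_equiv _ MulOpposite.opEquiv
  refine (simpleTargetSupport_finite.{_, w} 𝔞 h𝔞 S I hfg _
    (regularRep k (M2 (𝓞 K ⧸ I))ᵐᵒᵖ) rfl).subset ?_
  rintro φ ⟨E, _, _, _, ρ, Φ, ⟨a, ha, hocc⟩, hΦ⟩
  have hmem : φ ∈ heckeSupport 𝔞 h𝔞 S I ρ :=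
    mem_charSupport_of_eigenvector ha fun π => by
      rw [← hΦ π]
      exact hocc ⟨heckeT 𝔞 h𝔞 (inflate I ρ) π, Algebra.subset_adjoin ⟨π, π.2, rfl⟩⟩
  obtain ⟨E₀, _, _, _, ρ₀, hs₀, hφ⟩ := exists_simple_of_mem_heckeSupport 𝔞 h𝔞 S I _ ρ rfl hmem
  obtain ⟨x, hx⟩ := exists_ne (0 : E₀)
  -- The orbit map of a non-zero vector `x`; it is non-zero because it sends the identity to `x`.
  refine ⟨E₀, _, _, ρ₀, Finsupp.linearCombination k fun m => ρ₀ m x, ?_, ?_, hs₀, hφ⟩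
  · intro m y
    induction y using Finsupp.induction_linear with
    | zero => simp
    | add y z hy hz => simp only [map_add, hy, hz]
    | single m' t => simp [regularRep]
  · intro h
    have := LinearMap.congr_fun h (Finsupp.single 1 1)
    simp [hx] at this

end Devissage

/-! ### Generators from a connected space -/

section Generation

/-- If `G` acts on a space containing a connected invariant set `P` which is covered by the
translates of an open set `U`, then `G` is generated by the elements `g` with `g U ∩ U ∩ P ≠ ∅`. -/
theorem eq_top_of_isPreconnected {G X : Type*} [Group G] [TopologicalSpace X] (τ : G → X → X)
    (hone : ∀ x, τ 1 x = x) (hmul : ∀ g h x, τ (g * h) x = τ g (τ h x))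
    (hcont : ∀ g, Continuous (τ g)) {P U : Set X} (hP : IsPreconnected P) (hne : P.Nonempty)
    (hinv : ∀ g, ∀ x ∈ P, τ g x ∈ P) (hU : IsOpen U) (hcover : ∀ x ∈ P, ∃ g, τ g x ∈ U)
    (T : Subgroup G) (hT : ∀ g, ∀ x ∈ P, x ∈ U → τ g x ∈ U → g ∈ T) : T = ⊤ := by
  obtain ⟨x₀, hx₀P, hx₀U⟩ : ∃ x ∈ P, x ∈ U := by
    obtain ⟨x, hx⟩ := hne
    obtain ⟨g, hg⟩ := hcover x hx
    exact ⟨_, hinv g x hx, hg⟩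
  by_contra hcon
  obtain ⟨g₀, hg₀⟩ : ∃ g, g ∉ T := by
    by_contra h
    push Not at h
    exact hcon ((Subgroup.eq_top_iff' T).2 h)
  have hopen : ∀ s : Set G, IsOpen {x | ∃ g ∈ s, τ g x ∈ U} := by
    intro s
    have : {x | ∃ g ∈ s, τ g x ∈ U} = ⋃ g ∈ s, τ g ⁻¹' U := by ext; simp
    rw [this]
    exact isOpen_biUnion fun g _ => hU.preimage (hcont g)
  -- The points moved into `U` by `T` and those moved into `U` by its complement form two open sets
  -- that cover `P` and both meet it. By connectedness they share a point of `P`, and then `g * t⁻¹`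
  -- moves a point of `U` into `U`.
  obtain ⟨x, hxP, ⟨t, ht, htx⟩, ⟨g, hg, hgx⟩⟩ := hP {x | ∃ g ∈ (T : Set G), τ g x ∈ U}
    {x | ∃ g ∈ (T : Set G)ᶜ, τ g x ∈ U} (hopen _) (hopen _)
    (fun x hx => by
      obtain ⟨g, hg⟩ := hcover x hx
      by_cases h : g ∈ T
      · exact Or.inl ⟨g, h, hg⟩
      · exact Or.inr ⟨g, h, hg⟩)
    ⟨x₀, hx₀P, 1, T.one_mem, by rwa [hone]⟩
    ⟨τ g₀⁻¹ x₀, hinv _ _ hx₀P, g₀, hg₀, by rwa [← hmul, mul_inv_cancel, hone]⟩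
  have h1 := hT (g * t⁻¹) (τ t x) (hinv t x hxP) htx (by
    rwa [← hmul, mul_assoc, inv_mul_cancel, mul_one])
  exact hg (by simpa using T.mul_mem h1 ht)

end Generation

/-! ### Binary Hermitian forms -/

section HermitianForms

open ComplexConjugate

/-- The value of the sesquilinear form with matrix `A` at the row vector `(x, y)`. -/
noncomputable def herm (A : M2 ℂ) (x y : ℂ) : ℝ :=
  (A 0 0 * x * conj x + A 0 1 * x * conj y + A 1 0 * y * conj x + A 1 1 * y * conj y).re

/-- The positive definite Hermitian forms. -/
def posForms : Set (M2 ℂ) :=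
  {A | A.conjTranspose = A ∧ ∀ x y : ℂ, x ≠ 0 ∨ y ≠ 0 → 0 < herm A x y}

theorem convex_posForms : Convex ℝ posForms := by
  intro A hA B hB s t hs ht hst
  refine ⟨?_, fun x y hxy => ?_⟩
  · rw [Matrix.conjTranspose_add, Matrix.conjTranspose_smul, Matrix.conjTranspose_smul, hA.1, hB.1]
    simp
  · have e : herm (s • A + t • B) x y = s * herm A x y + t * herm B x y := by
      simp only [herm, Matrix.add_apply, Matrix.smul_apply, Complex.real_smul, Complex.add_re,
        Complex.mul_re, Complex.mul_im, Complex.add_im, Complex.ofReal_re, Complex.ofReal_im]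
      ring
    rw [e]
    have h1 := hA.2 x y hxy
    have h2 := hB.2 x y hxy
    rcases hs.eq_or_lt with rfl | hs
    · have : t = 1 := by linarith
      subst this
      linarith
    · have := mul_pos hs h1
      have := mul_nonneg ht h2.le
      linarith

theorem one_mem_posForms : (1 : M2 ℂ) ∈ posForms := by
  refine ⟨Matrix.conjTranspose_one, fun x y hxy => ?_⟩
  have e : herm 1 x y = Complex.normSq x + Complex.normSq y := by
    simp [herm, Complex.normSq_apply]
  rw [e]
  rcases hxy with h | h
  · have := Complex.normSq_pos.2 h
    have := Complex.normSq_nonneg y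
    linarith
  · have := Complex.normSq_pos.2 h
    have := Complex.normSq_nonneg x
    linarith

/-- Completing the square; all later estimates on forms rest on this identity. -/
theorem mul_herm {A : M2 ℂ} (hA : A.conjTranspose = A) (x y : ℂ) :
    (A 0 0).re * herm A x y =
      ‖A 0 0 * x + conj (A 0 1) * y‖ ^ 2 + A.det.re * ‖y‖ ^ 2 := by
  have h00 : conj (A 0 0) = A 0 0 := congrFun (congrFun hA 0) 0
  have h11 : conj (A 1 1) = A 1 1 := congrFun (congrFun hA 1) 1
  have h10 : A 1 0 = conj (A 0 1) := (congrFun (congrFun hA 1) 0).symm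
  rw [Complex.conj_eq_iff_im] at h00 h11
  rw [Complex.sq_norm, Complex.sq_norm, Matrix.det_fin_two, herm, h10]
  simp only [Complex.normSq_apply, Complex.add_re, Complex.sub_re, Complex.add_im, Complex.mul_re,
    Complex.mul_im, Complex.conj_re, Complex.conj_im, h00, h11]
  ring

theorem apply_zero_zero {A : M2 ℂ} (hA : A.conjTranspose = A) : A 0 0 = ((A 0 0).re : ℂ) :=
  (Complex.conj_eq_iff_re.1 (congrFun (congrFun hA 0) 0)).symm

theorem herm_one_zero (A : M2 ℂ) : herm A 1 0 = (A 0 0).re := by simp [herm]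

theorem re_pos_of_mem_posForms {A : M2 ℂ} (hA : A ∈ posForms) : 0 < (A 0 0).re := by
  rw [← herm_one_zero]
  exact hA.2 1 0 (Or.inl one_ne_zero)

theorem norm_zero_zero {A : M2 ℂ} (hA : A ∈ posForms) : ‖A 0 0‖ = (A 0 0).re := by
  have ha := re_pos_of_mem_posForms hA
  rw [apply_zero_zero hA.1, Complex.norm_real, Real.norm_of_nonneg (by simpa using ha.le)]
  simp

theorem det_pos_of_mem_posForms {A : M2 ℂ} (hA : A ∈ posForms) : 0 < A.det.re := by
  have ha := re_pos_of_mem_posForms hA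
  have ha' : A 0 0 ≠ 0 := fun h => by simp [h] at ha
  -- At this vector the completed square vanishes and only the determinant term is left.
  have h1 := mul_herm hA.1 (-conj (A 0 1)) (A 0 0)
  have h2 := mul_pos ha (hA.2 (-conj (A 0 1)) (A 0 0) (Or.inr ha'))
  rw [h1, mul_neg, mul_comm (A 0 0), neg_add_cancel, norm_zero] at h2
  have h3 : 0 < ‖A 0 0‖ ^ 2 := by positivity
  by_contra h
  push Not at h
  have := mul_nonneg (neg_nonneg.2 h) h3.le
  linarith

/-- The forms which are nearly reduced, with constant `C`. -/
def reducedForms (C : ℝ) : Set (M2 ℂ) :=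
  {A | ‖A 0 1‖ < C * (A 0 0).re ∧ (A 0 0).re ^ 2 < C ^ 2 * A.det.re}

theorem isOpen_reducedForms (C : ℝ) : IsOpen (reducedForms C) := by
  have h1 : IsOpen {A : M2 ℂ | ‖A 0 1‖ < C * (A 0 0).re} := isOpen_lt (by fun_prop) (by fun_prop)
  have hd : Continuous fun A : M2 ℂ => A.det := continuous_id.matrix_det
  have h2 : IsOpen {A : M2 ℂ | (A 0 0).re ^ 2 < C ^ 2 * A.det.re} :=
    isOpen_lt (by fun_prop) (by fun_prop)
  exact h1.inter h2

/-- The entry bounds for an upper row `(p, q)` moving one reduced form to another. -/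
theorem row_bound {C : ℝ} (hC : 0 ≤ C) {A A' : M2 ℂ} (hA : A ∈ posForms)
    (hA' : 0 < (A' 0 0).re) (hdet : A'.det.re = A.det.re)
    (hU : A ∈ reducedForms C) (hU' : A' ∈ reducedForms C) {p q : ℂ}
    (h00 : (A' 0 0).re = herm A p q) :
    ‖q‖ ≤ C ∧ (1 ≤ ‖q‖ → ‖p‖ ≤ C ^ 2 + C) := by
  have ha := re_pos_of_mem_posForms hA
  have hD := det_pos_of_mem_posForms hA
  obtain ⟨hb, haD⟩ := hU
  obtain ⟨hb', haD'⟩ := hU'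
  have hn := norm_zero_zero hA
  have key := mul_herm hA.1 p q
  have htri : ‖A 0 0 * p‖ ≤ ‖A 0 0 * p + conj (A 0 1) * q‖ + ‖conj (A 0 1) * q‖ := by
    have := norm_sub_le (A 0 0 * p + conj (A 0 1) * q) (conj (A 0 1) * q)
    rwa [add_sub_cancel_right] at this
  rw [norm_mul, norm_mul, RCLike.norm_conj, hn] at htri
  rw [← h00] at key
  rw [hdet] at haD'
  set a := (A 0 0).re
  set a' := (A' 0 0).re
  set D := A.det.re
  set z := ‖A 0 0 * p + conj (A 0 1) * q‖
  have hz : 0 ≤ z := norm_nonneg _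
  have hq : 0 ≤ ‖q‖ := norm_nonneg _
  -- Both `a ^ 2` and `a' ^ 2` are below `C ^ 2 * D`, hence so is their geometric mean. As `D * ‖q‖
  -- ^ 2 ≤ a * a'`, this bounds `q`.
  have haa : a * a' < C ^ 2 * D := by nlinarith [sq_nonneg (a - a')]
  have hqC : ‖q‖ ≤ C := by
    refine abs_le_of_sq_le_sq' ?_ hC |>.2
    have : D * ‖q‖ ^ 2 < D * C ^ 2 := by nlinarith [sq_nonneg z]
    exact (lt_of_mul_lt_mul_left this hD.le).le
  refine ⟨hqC, fun h1 => ?_⟩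
  have hDa : D ≤ a * a' := by
    have : 1 ≤ ‖q‖ ^ 2 := one_le_pow₀ h1
    nlinarith [sq_nonneg z]
  -- Here `a' ^ 2 < C ^ 2 * D ≤ C ^ 2 * a * a'`, where the last inequality uses `1 ≤ ‖q‖`.
  have ha'a : a' ≤ C ^ 2 * a := by
    have : a' * a' ≤ a' * (C ^ 2 * a) := by nlinarith [sq_nonneg C]
    exact le_of_mul_le_mul_left this hA'
  have hzC : z ≤ C * a := by
    refine abs_le_of_sq_le_sq' ?_ (by positivity) |>.2
    have : z ^ 2 ≤ a * a' := by nlinarith [sq_nonneg ‖q‖]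
    calc z ^ 2 ≤ a * a' := this
      _ ≤ a * (C ^ 2 * a) := mul_le_mul_of_nonneg_left ha'a ha.le
      _ = (C * a) ^ 2 := by ring
  have hbq : ‖A 0 1‖ * ‖q‖ ≤ C * a * C := mul_le_mul hb.le hqC hq (by positivity)
  have : a * ‖p‖ ≤ a * (C ^ 2 + C) := by linarith
  exact le_of_mul_le_mul_left this ha

end HermitianForms

/-! ### The action on forms, and lattices in the complex plane -/

section FormAction

open ComplexConjugate

variable {R : Type*} [CommRing R] (σ : R →+* ℂ)

/-- The action `A ↦ g A gᴴ` of `SL₂(R)` on complex matrices, for `R` embedded in `ℂ`. -/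
noncomputable def formAct (g : SL(2, R)) (A : M2 ℂ) : M2 ℂ :=
  σ.mapMatrix (g : M2 R) * A * (σ.mapMatrix (g : M2 R)).conjTranspose

theorem formAct_one (A : M2 ℂ) : formAct σ 1 A = A := by simp [formAct]

theorem formAct_mul (g h : SL(2, R)) (A : M2 ℂ) :
    formAct σ (g * h) A = formAct σ g (formAct σ h A) := by
  simp only [formAct, Matrix.SpecialLinearGroup.coe_mul, map_mul, Matrix.conjTranspose_mul,
    Matrix.mul_assoc]

theorem continuous_formAct (g : SL(2, R)) : Continuous (formAct σ g) := by
  unfold formAct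
  fun_prop

theorem det_formAct (g : SL(2, R)) (A : M2 ℂ) : (formAct σ g A).det = A.det := by
  have h : (σ.mapMatrix (g : M2 R)).det = 1 := by rw [← RingHom.map_det, g.2, map_one]
  rw [formAct, Matrix.det_mul, Matrix.det_mul, Matrix.det_conjTranspose, h]
  simp

theorem formAct_apply (g : SL(2, R)) (A : M2 ℂ) (i j : Fin 2) :
    formAct σ g A i j = A 0 0 * σ (g i 0) * conj (σ (g j 0)) + A 0 1 * σ (g i 0) * conj (σ (g j 1)) +
      A 1 0 * σ (g i 1) * conj (σ (g j 0)) + A 1 1 * σ (g i 1) * conj (σ (g j 1)) := by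
  simp only [formAct, RingHom.mapMatrix_apply, Matrix.mul_apply, Fin.sum_univ_two, Matrix.map_apply,
    Matrix.conjTranspose_apply, RCLike.star_def]
  ring

theorem formAct_zero_zero_re (g : SL(2, R)) (A : M2 ℂ) :
    (formAct σ g A 0 0).re = herm A (σ (g 0 0)) (σ (g 0 1)) := by
  rw [formAct_apply, herm]

theorem herm_formAct (g : SL(2, R)) (A : M2 ℂ) (x y : ℂ) :
    herm (formAct σ g A) x y =
      herm A (x * σ (g 0 0) + y * σ (g 1 0)) (x * σ (g 0 1) + y * σ (g 1 1)) := by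
  simp only [herm, formAct_apply, map_add, map_mul]
  congr 1
  ring

theorem det_map_eq (g : SL(2, R)) :
    σ (g 0 0) * σ (g 1 1) - σ (g 0 1) * σ (g 1 0) = 1 := by
  rw [← map_mul, ← map_mul, ← map_sub, ← Matrix.det_fin_two, g.2, map_one]

theorem formAct_mem_posForms (g : SL(2, R)) {A : M2 ℂ} (hA : A ∈ posForms) :
    formAct σ g A ∈ posForms := by
  refine ⟨?_, fun x y hxy => ?_⟩
  · simp only [formAct, Matrix.conjTranspose_mul, Matrix.conjTranspose_conjTranspose, hA.1,
      Matrix.mul_assoc]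
  · rw [herm_formAct]
    apply hA.2
    by_contra h
    push Not at h
    have hd := det_map_eq σ g
    have hx : x = 0 := by linear_combination σ (g 1 1) * h.1 - σ (g 1 0) * h.2 - x * hd
    have hy : y = 0 := by linear_combination σ (g 0 0) * h.2 - σ (g 0 1) * h.1 - y * hd
    simp [hx, hy] at hxy

/-- A ring mapping to `ℂ` is a complex lattice if its non-zero elements have norm at least one,
finitely many of them have bounded norm and the image is not contained in `ℝ`. -/
structure IsComplexLattice (σ : R →+* ℂ) : Prop where
  one_le_norm : ∀ x, x ≠ 0 → 1 ≤ ‖σ x‖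
  finite_norm_le : ∀ B : ℝ, {x | ‖σ x‖ ≤ B}.Finite
  exists_im_ne_zero : ∃ θ, (σ θ).im ≠ 0

variable {σ}

/-- `row_bound` for `g` and for its inverse, whose upper row is `(g 1 1, -g 0 1)`, controls three
entries when `g 0 1 ≠ 0`; the determinant then gives the fourth. When `g 0 1 = 0` the diagonal
entries have norm one, and the off-diagonal condition on the transformed form bounds `g 1 0`. -/
theorem entries_bound (hσ : IsComplexLattice σ) {C : ℝ} (hC : 0 ≤ C) {A : M2 ℂ} (hA : A ∈ posForms)
    (hU : A ∈ reducedForms C) (g : SL(2, R)) (hgU : formAct σ g A ∈ reducedForms C) (i j : Fin 2) :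
    ‖σ (g i j)‖ ≤ (C ^ 2 + C + 1) ^ 2 + 1 := by
  have hA' := formAct_mem_posForms σ g hA
  have hback : formAct σ g⁻¹ (formAct σ g A) = A := by
    rw [← formAct_mul, inv_mul_cancel, formAct_one]
  have h1 := row_bound hC hA (re_pos_of_mem_posForms hA') (by rw [det_formAct]) hU hgU
    (formAct_zero_zero_re σ g A)
  have h2 := row_bound hC hA' (re_pos_of_mem_posForms hA) (by rw [det_formAct]) hgU hU
    (p := σ (g 1 1)) (q := -σ (g 0 1)) (by
      conv_lhs => rw [← hback, formAct_zero_zero_re]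
      simp [Matrix.SpecialLinearGroup.coe_inv, Matrix.adjugate_fin_two])
  rw [norm_neg] at h2
  have hd := det_map_eq σ g
  have ha := re_pos_of_mem_posForms hA
  have hn := norm_zero_zero hA
  have hb' := hgU.1
  have hb := hU.1
  rw [formAct_zero_zero_re] at hb'
  rw [formAct_apply] at hb'
  have e01 : ‖σ (g 0 1)‖ ≤ C ^ 2 + C + 1 := by nlinarith [h1.1]
  suffices h : ‖σ (g 0 0)‖ ≤ C ^ 2 + C + 1 ∧ ‖σ (g 1 1)‖ ≤ C ^ 2 + C + 1 ∧
      ‖σ (g 1 0)‖ ≤ (C ^ 2 + C + 1) ^ 2 + 1 by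
    have hB : C ^ 2 + C + 1 ≤ (C ^ 2 + C + 1) ^ 2 + 1 := by nlinarith [sq_nonneg (C ^ 2 + C)]
    fin_cases i <;> fin_cases j
    · exact h.1.trans hB
    · exact e01.trans hB
    · exact h.2.2
    · exact h.2.1.trans hB
  by_cases hq : g 0 1 = 0
  · rw [hq, map_zero] at hd hb'
    rw [zero_mul, sub_zero] at hd
    have hp0 : g 0 0 ≠ 0 := fun h => by simp [h] at hd
    have hs0 : g 1 1 ≠ 0 := fun h => by simp [h] at hd
    have hp := hσ.one_le_norm _ hp0
    have hs := hσ.one_le_norm _ hs0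
    have hps : ‖σ (g 0 0)‖ * ‖σ (g 1 1)‖ = 1 := by rw [← norm_mul, hd, norm_one]
    have hp1 : ‖σ (g 0 0)‖ = 1 := by nlinarith
    have hs1 : ‖σ (g 1 1)‖ = 1 := by nlinarith
    refine ⟨by rw [hp1]; nlinarith, by rw [hs1]; nlinarith, ?_⟩
    have e1 : herm A (σ (g 0 0)) 0 = (A 0 0).re := by
      have := mul_herm hA.1 (σ (g 0 0)) 0
      rw [mul_zero, add_zero, norm_zero, norm_mul, hp1, hn] at this
      refine mul_left_cancel₀ ha.ne' ?_
      rw [this]; ring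
    rw [e1] at hb'
    have e2 : A 0 0 * σ (g 0 0) * conj (σ (g 1 0)) + A 0 1 * σ (g 0 0) * conj (σ (g 1 1)) +
        A 1 0 * 0 * conj (σ (g 1 0)) + A 1 1 * 0 * conj (σ (g 1 1)) =
        σ (g 0 0) * (A 0 0 * conj (σ (g 1 0)) + A 0 1 * conj (σ (g 1 1))) := by ring
    rw [e2, norm_mul, hp1, one_mul] at hb'
    have htri := norm_sub_le (A 0 0 * conj (σ (g 1 0)) + A 0 1 * conj (σ (g 1 1)))
      (A 0 1 * conj (σ (g 1 1)))
    rw [add_sub_cancel_right, norm_mul, norm_mul, RCLike.norm_conj, RCLike.norm_conj, hs1, hn,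
      mul_one] at htri
    -- Both off-diagonal entries have norm below `C * (A 0 0).re`, because the two forms share their
    -- leading coefficient.
    have : (A 0 0).re * ‖σ (g 1 0)‖ ≤ (A 0 0).re * (2 * C) := by linarith
    have := le_of_mul_le_mul_left this ha
    nlinarith [sq_nonneg (C - 1), sq_nonneg (C ^ 2 + C)]
  · have hq1 := hσ.one_le_norm _ hq
    have hp := h1.2 hq1
    have hs := h2.2 hq1
    refine ⟨by linarith, by linarith, ?_⟩
    have e : σ (g 0 1) * σ (g 1 0) = σ (g 0 0) * σ (g 1 1) - 1 := by linear_combination -hd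
    have h3 : ‖σ (g 0 1)‖ * ‖σ (g 1 0)‖ ≤ ‖σ (g 0 0)‖ * ‖σ (g 1 1)‖ + 1 := by
      rw [← norm_mul, e, ← norm_mul]
      simpa using norm_sub_le (σ (g 0 0) * σ (g 1 1)) 1
    have h4 : ‖σ (g 0 0)‖ * ‖σ (g 1 1)‖ ≤ (C ^ 2 + C) * (C ^ 2 + C) :=
      mul_le_mul hp hs (norm_nonneg _) (by positivity)
    have h5 : ‖σ (g 1 0)‖ ≤ ‖σ (g 0 1)‖ * ‖σ (g 1 0)‖ := le_mul_of_one_le_left (norm_nonneg _) hq1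
    nlinarith [sq_nonneg C]

theorem finite_entries_bound (hσ : IsComplexLattice σ) (B : ℝ) :
    {g : SL(2, R) | ∀ i j, ‖σ (g i j)‖ ≤ B}.Finite := by
  have h : (Set.univ.pi fun _ : Fin 2 => Set.univ.pi fun _ : Fin 2 => {x | ‖σ x‖ ≤ B}).Finite :=
    Set.Finite.pi fun _ => Set.Finite.pi fun _ => hσ.finite_norm_le B
  refine Set.Finite.of_finite_image (f := fun g : SL(2, R) => fun i j => g i j)
    (h.subset ?_) ?_
  · rintro _ ⟨g, hg, rfl⟩ i _ j _
    exact hg i j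
  · intro g _ h _ e
    ext i j
    exact congrFun (congrFun e i) j

/-- A non-real number spans the complex plane together with `1`. -/
theorem exists_real_coordinates {τ : ℂ} (hτ : τ.im ≠ 0) (w : ℂ) :
    ∃ u v : ℝ, w = u + v * τ := by
  refine ⟨w.re - w.im / τ.im * τ.re, w.im / τ.im, ?_⟩
  apply Complex.ext
  · simp
  · simp [hτ]

theorem norm_add_mul_le {u v ε : ℝ} (hu : |u| ≤ ε) (hv : |v| ≤ ε) (τ : ℂ) :
    ‖(u + v * τ : ℂ)‖ ≤ ε * (1 + ‖τ‖) := by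
  refine (norm_add_le _ _).trans ?_
  rw [norm_mul, Complex.norm_real, Complex.norm_real, Real.norm_eq_abs, Real.norm_eq_abs]
  nlinarith [norm_nonneg τ]

/-- Coordinates with respect to `1` and a non-real `σ θ` are rounded down; the sublattice they span
suffices. -/
theorem exists_covering_radius (hσ : IsComplexLattice σ) :
    ∃ r : ℝ, 0 ≤ r ∧ ∀ w : ℂ, ∃ x : R, ‖w + σ x‖ ≤ r := by
  obtain ⟨θ, hθ⟩ := hσ.exists_im_ne_zero
  refine ⟨1 * (1 + ‖σ θ‖), by positivity, fun w => ?_⟩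
  obtain ⟨u, v, rfl⟩ := exists_real_coordinates hθ w
  refine ⟨-(⌊u⌋ : R) - (⌊v⌋ : R) * θ, ?_⟩
  have e : (u + v * σ θ + σ (-(⌊u⌋ : R) - (⌊v⌋ : R) * θ) : ℂ) =
      ((Int.fract u : ℝ) : ℂ) + ((Int.fract v : ℝ) : ℂ) * σ θ := by
    simp only [map_sub, map_neg, map_mul, map_intCast, Int.fract, Complex.ofReal_sub,
      Complex.ofReal_intCast]
    ring
  rw [e]
  refine norm_add_mul_le ?_ ?_ _
  · rw [abs_of_nonneg (Int.fract_nonneg u)]; exact (Int.fract_lt_one u).le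
  · rw [abs_of_nonneg (Int.fract_nonneg v)]; exact (Int.fract_lt_one v).le

theorem abs_fract_sub_le {M : ℕ} (hM : 0 < M) {s t : ℝ}
    (h : ⌊(M : ℝ) * s⌋ = ⌊(M : ℝ) * t⌋) : |s - t| ≤ 1 / M := by
  have h1 := Int.abs_sub_lt_one_of_floor_eq_floor h
  have hM' : (0 : ℝ) < M := by exact_mod_cast hM
  rw [← mul_sub, abs_mul, abs_of_pos hM'] at h1
  rw [le_div_iff₀ hM', mul_comm]
  exact h1.le

theorem floor_mul_fract_mem (M : ℕ) (hM : 0 < M) (t : ℝ) :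
    ⌊(M : ℝ) * Int.fract t⌋ ∈ Finset.Ico (0 : ℤ) M := by
  have hM' : (0 : ℝ) < M := by exact_mod_cast hM
  rw [Finset.mem_Ico]
  refine ⟨Int.floor_nonneg.2 (mul_nonneg hM'.le (Int.fract_nonneg t)), Int.floor_lt.2 ?_⟩
  have := mul_lt_mul_of_pos_left (Int.fract_lt_one t) hM'
  push_cast
  linarith

/-- Dirichlet approximation of complex numbers by lattice points. -/
theorem exists_dirichlet (hσ : IsComplexLattice σ) :
    ∃ N : ℕ, ∀ w : ℂ, ∃ (x : R) (n : ℕ), 0 < n ∧ n ≤ N ∧ ‖σ x + n * w‖ ≤ 1 / 2 := by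
  obtain ⟨θ, hθ⟩ := hσ.exists_im_ne_zero
  -- Two multiples of `w` in the same box of side `1 / M` differ, modulo the lattice, by at most `(1
  -- + ‖σ θ‖) / M ≤ 1 / 2`; `M * M + 1` multiples compete for `M * M` boxes.
  obtain ⟨M, hM⟩ := exists_nat_ge (2 * (1 + ‖σ θ‖))
  have hMpos' : (0 : ℝ) < M := lt_of_lt_of_le (by positivity) hM
  have hMpos : 0 < M := by exact_mod_cast hMpos'
  refine ⟨M * M, fun w => ?_⟩
  obtain ⟨u, v, rfl⟩ := exists_real_coordinates hθ w
  obtain ⟨n, hn, m, hm, hne, heq⟩ := Finset.exists_ne_map_eq_of_card_lt_of_maps_to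
    (s := Finset.range (M * M + 1)) (t := Finset.Ico (0 : ℤ) M ×ˢ Finset.Ico (0 : ℤ) M)
    (f := fun n => (⌊(M : ℝ) * Int.fract (n * u)⌋, ⌊(M : ℝ) * Int.fract (n * v)⌋))
    (by simp) (fun n _ => by
      simp only [Finset.coe_product, Set.mem_prod, Finset.mem_coe]
      exact ⟨floor_mul_fract_mem M hMpos _, floor_mul_fract_mem M hMpos _⟩)
  wlog hlt : n < m generalizing n m
  · exact this m hm n hn hne.symm heq.symm (by omega)
  rw [Prod.mk.injEq] at heq
  have hu := abs_fract_sub_le hMpos heq.1.symm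
  have hv := abs_fract_sub_le hMpos heq.2.symm
  refine ⟨((⌊(n : ℝ) * u⌋ - ⌊(m : ℝ) * u⌋ : ℤ) : R) + ((⌊(n : ℝ) * v⌋ - ⌊(m : ℝ) * v⌋ : ℤ) : R) * θ,
    m - n, by omega, by have := Finset.mem_range.1 hm; omega, ?_⟩
  have e : σ (((⌊(n : ℝ) * u⌋ - ⌊(m : ℝ) * u⌋ : ℤ) : R) +
      ((⌊(n : ℝ) * v⌋ - ⌊(m : ℝ) * v⌋ : ℤ) : R) * θ) + ((m - n : ℕ) : ℂ) * (u + v * σ θ) =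
      ((Int.fract (m * u) - Int.fract (n * u) : ℝ) : ℂ) +
        ((Int.fract (m * v) - Int.fract (n * v) : ℝ) : ℂ) * σ θ := by
    rw [Nat.cast_sub hlt.le]
    simp only [map_add, map_mul, map_intCast, Int.fract]
    push_cast
    ring
  rw [e]
  refine (norm_add_mul_le hu hv _).trans ?_
  rw [div_mul_eq_mul_div, one_mul, div_le_div_iff₀ hMpos' two_pos]
  linarith

end FormAction

/-! ### Reduction theory and finite generation of $\mathrm{SL}_2$ -/

section Reduction

open ComplexConjugate

variable {R : Type*} [CommRing R] {σ : R →+* ℂ}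

theorem herm_mul (A : M2 ℂ) (c x y : ℂ) : herm A (c * x) (c * y) = ‖c‖ ^ 2 * herm A x y := by
  rw [Complex.sq_norm]
  simp only [herm, map_mul, Complex.normSq_apply, Complex.add_re, Complex.mul_re, Complex.mul_im,
    Complex.conj_re, Complex.conj_im]
  ring

theorem finite_herm_le (hσ : IsComplexLattice σ) {A : M2 ℂ} (hA : A ∈ posForms) (B : ℝ) :
    {v : R × R | herm A (σ v.1) (σ v.2) ≤ B}.Finite := by
  have ha := re_pos_of_mem_posForms hA
  have hD := det_pos_of_mem_posForms hA
  have hn := norm_zero_zero hA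
  set a := (A 0 0).re with ha_def
  set D := A.det.re with hD_def
  -- The summand `1` turns a bound on a square into a bound on the norm: `t ^ 2 ≤ X` implies `t ≤ X
  -- + 1`.
  set B₂ := a * B / D + 1
  refine ((hσ.finite_norm_le ((a * B + 1 + ‖A 0 1‖ * B₂) / a)).prod
    (hσ.finite_norm_le B₂)).subset ?_
  rintro ⟨p, q⟩ (h : herm A (σ p) (σ q) ≤ B)
  have key := mul_herm hA.1 (σ p) (σ q)
  have hle : a * herm A (σ p) (σ q) ≤ a * B := mul_le_mul_of_nonneg_left h ha.le
  rw [key] at hle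
  have htri := norm_sub_le (A 0 0 * σ p + conj (A 0 1) * σ q) (conj (A 0 1) * σ q)
  rw [add_sub_cancel_right, norm_mul, norm_mul, RCLike.norm_conj, hn] at htri
  set z := ‖A 0 0 * σ p + conj (A 0 1) * σ q‖
  have hq : ‖σ q‖ ≤ B₂ := by
    have h1 : ‖σ q‖ ^ 2 ≤ a * B / D := by
      rw [le_div_iff₀ hD]; nlinarith [sq_nonneg z]
    nlinarith [sq_nonneg (‖σ q‖ - 1), norm_nonneg (σ q)]
  refine ⟨?_, hq⟩
  have hz : z ≤ a * B + 1 := by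
    have : 0 ≤ D * ‖σ q‖ ^ 2 := by positivity
    nlinarith [sq_nonneg (z - 1)]
  have := mul_le_mul_of_nonneg_left hq (norm_nonneg (A 0 1))
  change ‖σ p‖ ≤ _
  rw [le_div_iff₀ ha, mul_comm]
  linarith

/-- A minimal vector exists by finiteness. Dividing it by its gcd does not increase the value, since
non-zero lattice elements have norm at least one, and Bézout completes the primitive vector to a
matrix. This is where the principal ideal hypothesis enters. -/
theorem exists_minimal_row [IsDomain R] [IsPrincipalIdealRing R] (hσ : IsComplexLattice σ)
    {A : M2 ℂ} (hA : A ∈ posForms) :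
    ∃ g : SL(2, R), ∀ x y : R, x ≠ 0 ∨ y ≠ 0 →
      (formAct σ g A 0 0).re ≤ herm (formAct σ g A) (σ x) (σ y) := by
  have hfin : {v : R × R | herm A (σ v.1) (σ v.2) ≤ herm A 1 0 ∧ v ≠ 0}.Finite :=
    (finite_herm_le hσ hA _).subset fun v hv => hv.1
  obtain ⟨⟨p, q⟩, hpq, hmin⟩ := Set.exists_min_image _
    (fun v : R × R => herm A (σ v.1) (σ v.2)) hfin ⟨(1, 0), by simp⟩
  have hmin' : ∀ x y : R, x ≠ 0 ∨ y ≠ 0 → herm A (σ p) (σ q) ≤ herm A (σ x) (σ y) := by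
    intro x y hxy
    rcases le_total (herm A (σ x) (σ y)) (herm A 1 0) with h | h
    · refine hmin (x, y) ⟨h, fun e => ?_⟩
      rw [Prod.mk_eq_zero] at e
      simp [e.1, e.2] at hxy
    · exact hpq.1.trans h
  obtain ⟨p', hp'⟩ := IsBezout.gcd_dvd_left p q
  obtain ⟨q', hq'⟩ := IsBezout.gcd_dvd_right p q
  obtain ⟨α, β, hαβ⟩ := IsBezout.gcd_eq_sum p q
  set n := IsBezout.gcd p q
  have hn : n ≠ 0 := by
    intro h
    rw [h, zero_mul] at hp' hq'
    exact hpq.2 (by rw [hp', hq']; rfl)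
  have hone : α * p' + β * q' = 1 := by
    apply mul_left_cancel₀ hn
    linear_combination hαβ - α * hp' - β * hq'
  let g : SL(2, R) := ⟨!![p', q'; -β, α], by rw [Matrix.det_fin_two_of]; linear_combination hone⟩
  have hle : herm A (σ p') (σ q') ≤ herm A (σ p) (σ q) := by
    have hne : σ p' ≠ 0 ∨ σ q' ≠ 0 := by
      by_contra h
      push Not at h
      have := congrArg σ hone
      simp [h.1, h.2] at this
    have hpos := hA.2 _ _ hne
    have e : herm A (σ p) (σ q) = ‖σ n‖ ^ 2 * herm A (σ p') (σ q') := by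
      rw [← herm_mul, ← map_mul, ← map_mul, ← hp', ← hq']
    rw [e]
    exact le_mul_of_one_le_left hpos.le (one_le_pow₀ (hσ.one_le_norm n hn))
  refine ⟨g, fun x y hxy => ?_⟩
  rw [formAct_zero_zero_re, herm_formAct]
  simp only [← map_mul, ← map_add]
  refine hle.trans (hmin' _ _ ?_)
  by_contra h
  push Not at h
  have hd := g.2
  rw [Matrix.det_fin_two] at hd
  have hx : x = 0 := by linear_combination g 1 1 * h.1 - g 1 0 * h.2 - x * hd
  have hy : y = 0 := by linear_combination g 0 0 * h.2 - g 0 1 * h.1 - y * hd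
  simp [hx, hy] at hxy

/-- Once the leading coefficient is minimal, a lower unipotent matrix shrinks the off-diagonal entry
to the covering radius times that coefficient, which it leaves unchanged. Dirichlet approximation
supplies a test vector `(x, n)` at which minimality bounds the coefficient by the determinant. -/
theorem exists_reduced_form [IsDomain R] [IsPrincipalIdealRing R] (hσ : IsComplexLattice σ) :
    ∃ C : ℝ, 0 ≤ C ∧ ∀ A ∈ posForms, ∃ g : SL(2, R), formAct σ g A ∈ reducedForms C := by
  obtain ⟨r, hr0, hr⟩ := exists_covering_radius hσ
  obtain ⟨N, hN⟩ := exists_dirichlet hσ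
  refine ⟨r + 2 * N + 1, by positivity, fun A hA => ?_⟩
  obtain ⟨g, hg⟩ := exists_minimal_row hσ hA
  have hA' := formAct_mem_posForms σ g hA
  set A' := formAct σ g A
  have ha := re_pos_of_mem_posForms hA'
  have hD := det_pos_of_mem_posForms hA'
  have ha0 : A' 0 0 ≠ 0 := fun h => by simp [h] at ha
  have hn := norm_zero_zero hA'
  obtain ⟨t, ht⟩ := hr (conj (A' 0 1) / A' 0 0)
  obtain ⟨x, n, hn0, hnN, hxn⟩ := hN (conj (A' 0 1) / A' 0 0)
  let u : SL(2, R) := ⟨!![1, 0; t, 1], by rw [Matrix.det_fin_two_of]; ring⟩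
  have h00 : formAct σ u A' 0 0 = A' 0 0 := by
    rw [formAct_apply]; simp [u]
  have h01 : formAct σ u A' 0 1 = A' 0 0 * conj (σ t) + A' 0 1 := by
    rw [formAct_apply]; simp [u]
  refine ⟨u * g, ?_⟩
  rw [formAct_mul]
  have hN0 : (0 : ℝ) ≤ N := Nat.cast_nonneg N
  constructor
  · rw [h00, h01]
    have e : conj (A' 0 0 * conj (σ t) + A' 0 1) =
        A' 0 0 * (conj (A' 0 1) / A' 0 0 + σ t) := by
      have hc : conj (A' 0 0) = A' 0 0 := congrFun (congrFun hA'.1 0) 0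
      rw [mul_add, mul_div_cancel₀ _ ha0]
      simp only [map_add, map_mul, Complex.conj_conj, hc]
      ring
    rw [← RCLike.norm_conj, e, norm_mul, hn, mul_comm]
    exact mul_lt_mul_of_pos_right (by linarith) ha
  · rw [h00, det_formAct]
    have hn0' : (n : R) ≠ 0 := by
      intro h
      have := congrArg σ h
      rw [map_natCast, map_zero, Nat.cast_eq_zero] at this
      omega
    have h1 := hg x n (Or.inr hn0')
    have h2 := mul_herm hA'.1 (σ x) (σ n)
    have e : A' 0 0 * σ x + conj (A' 0 1) * σ n =
        A' 0 0 * (σ x + n * (conj (A' 0 1) / A' 0 0)) := by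
      rw [map_natCast]; field_simp
    rw [e, norm_mul, hn, map_natCast, Complex.norm_natCast] at h2
    rw [map_natCast] at h1
    set a := (A' 0 0).re
    set D := A'.det.re
    -- Together these give `a ^ 2 ≤ a ^ 2 / 4 + D * N ^ 2`, hence `a ^ 2 ≤ 2 * D * N ^ 2`, which the
    -- chosen constant exceeds.
    have h3 : a * a ≤ a * herm A' (σ x) n := mul_le_mul_of_nonneg_left h1 ha.le
    have h4 : (a * ‖σ x + n * (conj (A' 0 1) / A' 0 0)‖) ^ 2 ≤ (a * (1 / 2)) ^ 2 :=
      pow_le_pow_left₀ (by positivity) (mul_le_mul_of_nonneg_left hxn ha.le) 2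
    have h5 : D * (n : ℝ) ^ 2 ≤ D * (N : ℝ) ^ 2 :=
      mul_le_mul_of_nonneg_left
        (pow_le_pow_left₀ (Nat.cast_nonneg n) (by exact_mod_cast hnN) 2) hD.le
    have h6 : D * (2 * (N : ℝ) ^ 2) < D * (r + 2 * N + 1) ^ 2 :=
      mul_lt_mul_of_pos_left (by nlinarith [mul_nonneg hr0 hN0]) hD
    nlinarith [sq_nonneg a]

/-- `SL₂` of a principal ideal domain which is a lattice in `ℂ` is finitely generated. -/
theorem IsComplexLattice.fg_specialLinearGroup [IsDomain R] [IsPrincipalIdealRing R]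
    (hσ : IsComplexLattice σ) : Group.FG SL(2, R) := by
  obtain ⟨C, hC, hcover⟩ := exists_reduced_form hσ
  refine Group.fg_iff.2 ⟨{g | ∀ i j, ‖σ (g i j)‖ ≤ (C ^ 2 + C + 1) ^ 2 + 1}, ?_,
    finite_entries_bound hσ _⟩
  exact eq_top_of_isPreconnected (formAct σ) (formAct_one σ) (formAct_mul σ) (continuous_formAct σ)
    convex_posForms.isPreconnected ⟨1, one_mem_posForms⟩ (fun g _ hA => formAct_mem_posForms σ g hA)
    (isOpen_reducedForms C) hcover _ fun g A hA hU hgU =>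
      Subgroup.subset_closure fun i j => entries_bound hσ hC hA hU g hgU i j

end Reduction

/-! ### Imaginary quadratic fields -/

section ImaginaryQuadratic

variable {K : Type*} [Field K] [NumberField K]

/-- The only embeddings are `φ` and its conjugate, so all absolute values of `x` agree. Hence `‖φ x‖
^ 2` is the absolute value of an integer norm, and bounding one embedding bounds all of them. If the
image of `𝓞 K` were real, `φ` would equal its conjugate on the fraction field. -/
theorem isComplexLattice_of_imaginary_quadratic (hquad : Module.finrank ℚ K = 2)
    (himag : NumberField.IsTotallyComplex K) (φ : K →+* ℂ) :
    IsComplexLattice (φ.comp (algebraMap (𝓞 K) K)) := by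
  have hne : NumberField.ComplexEmbedding.conjugate φ ≠ φ :=
    fun h => NumberField.IsTotallyComplex.complexEmbedding_not_isReal φ
      (NumberField.ComplexEmbedding.isReal_iff.2 h)
  have hcard : Fintype.card (K →+* ℂ) = 2 := by
    rw [NumberField.Embeddings.card, hquad]
  have hall : ∀ (ψ : K →+* ℂ) (x : K), ‖ψ x‖ = ‖φ x‖ := by
    classical
    intro ψ x
    have huniv : ({NumberField.ComplexEmbedding.conjugate φ, φ} : Finset (K →+* ℂ)) = Finset.univ :=
      Finset.eq_univ_of_card _ (by rw [Finset.card_pair hne, hcard])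
    have hψ : ψ ∈ ({NumberField.ComplexEmbedding.conjugate φ, φ} : Finset (K →+* ℂ)) := by
      rw [huniv]; exact Finset.mem_univ ψ
    simp only [Finset.mem_insert, Finset.mem_singleton] at hψ
    rcases hψ with rfl | rfl
    · rw [NumberField.ComplexEmbedding.conjugate_coe_eq, RCLike.norm_conj]
    · rfl
  have hfin : ∀ B : ℝ, {x : 𝓞 K | ‖φ.comp (algebraMap (𝓞 K) K) x‖ ≤ B}.Finite := by
    intro B
    refine Set.Finite.of_finite_image (f := algebraMap (𝓞 K) K)
      ((NumberField.Embeddings.finite_of_norm_le K ℂ B).subset ?_)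
      NumberField.RingOfIntegers.coe_injective.injOn
    rintro _ ⟨x, hx, rfl⟩
    exact ⟨x.2, fun ψ => by rw [hall]; exact hx⟩
  refine ⟨fun x hx => ?_, hfin, ?_⟩
  · have hnorm := Algebra.norm_eq_prod_embeddings ℚ ℂ (x : K)
    have h1 : ‖algebraMap ℚ ℂ (Algebra.norm ℚ (x : K))‖ = ‖φ x‖ ^ 2 := by
      rw [hnorm, norm_prod, ← Fintype.prod_equiv (RingHom.equivRatAlgHom K ℂ)
        (fun f => ‖f x‖) _ fun f => by rfl, Finset.prod_congr rfl fun ψ _ => hall ψ x,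
        Finset.prod_const, Finset.card_univ, hcard]
    have h2 : Algebra.norm ℤ x ≠ 0 := Algebra.norm_ne_zero_iff.2 hx
    rw [← Algebra.coe_norm_int] at h1
    have h3 : (1 : ℝ) ≤ ‖φ x‖ ^ 2 := by
      rw [← h1]
      simp only [map_intCast, Complex.norm_intCast]
      exact_mod_cast Int.one_le_abs h2
    exact (one_le_sq_iff₀ (norm_nonneg _)).1 h3
  · by_contra hreal
    push Not at hreal
    apply hne
    ext x
    obtain ⟨a, b, hb, rfl⟩ := IsFractionRing.div_surjective (A := 𝓞 K) x
    have hc : ∀ a : 𝓞 K, NumberField.ComplexEmbedding.conjugate φ (algebraMap (𝓞 K) K a) =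
        φ (algebraMap (𝓞 K) K a) := fun a => by
      rw [NumberField.ComplexEmbedding.conjugate_coe_eq]
      exact Complex.conj_eq_iff_im.2 (hreal a)
    rw [map_div₀, map_div₀, hc, hc]

/-- The group contains the kernel of reduction to a finite group, so it has finite index in a
finitely generated group and Schreier's lemma applies. -/
theorem fg_Gamma1 (hquad : Module.finrank ℚ K = 2) (himag : NumberField.IsTotallyComplex K)
    (hclass : NumberField.classNumber K = 1) {𝔞 : Ideal (𝓞 K)} (h𝔞 : 𝔞 ≠ ⊥) :
    Group.FG (Gamma1 𝔞) := by
  have := NumberField.classNumber_eq_one_iff.1 hclass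
  obtain ⟨φ⟩ : Nonempty (K →+* ℂ) := inferInstance
  have := (isComplexLattice_of_imaginary_quadratic hquad himag φ).fg_specialLinearGroup
  have : Finite (𝓞 K ⧸ 𝔞) := Ideal.finiteQuotientOfFreeOfNeBot _ h𝔞
  have : Finite (M2 (𝓞 K ⧸ 𝔞)) := inferInstanceAs (Finite (Fin 2 → Fin 2 → 𝓞 K ⧸ 𝔞))
  have : Finite SL(2, 𝓞 K ⧸ 𝔞) := Subtype.finite
  let f : SL(2, 𝓞 K) →* SL(2, 𝓞 K ⧸ 𝔞) :=
    Matrix.SpecialLinearGroup.map (Ideal.Quotient.mk 𝔞)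
  have hker : f.ker ≤ Gamma1 𝔞 := by
    intro g hg
    have hg' : f g = 1 := hg
    have h10 : Ideal.Quotient.mk 𝔞 (g 1 0) = 0 := by
      have := congrArg (fun m : SL(2, 𝓞 K ⧸ 𝔞) => m 1 0) hg'
      simpa [f] using this
    have h11 : Ideal.Quotient.mk 𝔞 (g 1 1) = 1 := by
      have := congrArg (fun m : SL(2, 𝓞 K ⧸ 𝔞) => m 1 1) hg'
      simpa [f] using this
    refine ⟨Ideal.Quotient.eq_zero_iff_mem.1 h10, ?_⟩
    rw [← map_one (Ideal.Quotient.mk 𝔞)] at h11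
    exact Ideal.Quotient.eq.1 h11
  have : (Gamma1 𝔞).FiniteIndex := Subgroup.finiteIndex_of_le hker
  infer_instance

end ImaginaryQuadratic

end BianchiHecke

theorem mainTheorem3 {K : Type*} [Field K] [NumberField K]
    (hquad : Module.finrank ℚ K = 2) (himag : NumberField.IsTotallyComplex K)
    (hclass : NumberField.classNumber K = 1)
    (ℓ : ℕ) (hℓ : ℓ.Prime)
    (hsplit : ∃ P Q : Ideal (𝓞 K), P.IsPrime ∧ Q.IsPrime ∧ P ≠ Q ∧
      P * Q = Ideal.span {(ℓ : 𝓞 K)})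
    (𝔞 : Ideal (𝓞 K)) (h𝔞 : 𝔞 ≠ ⊥) (hcop : IsCoprime 𝔞 (Ideal.span {(ℓ : 𝓞 K)}))
    {k : Type*} [Field k] [CharP k ℓ] :
    -- all modules over `GL₂(𝓞/ℓ)`, Hecke operators `T_π` for the primes `π` not dividing `ℓ`
    {φ : BianchiHecke.primesNotDividing (ℓ : 𝓞 K) → k |
      ∃ (E : Type*) (_ : AddCommGroup E) (_ : Module k E) (_ : FiniteDimensional k E)
        (ρ : Representation k (GL (Fin 2) (𝓞 K ⧸ Ideal.span {(ℓ : 𝓞 K)}))ᵐᵒᵖ E),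
        BianchiHecke.IsHeckeEigensystem 𝔞 h𝔞 _
          (BianchiHecke.inflate _ (BianchiHecke.extendByZero ρ)) φ}.Finite ∧
    -- modules on which `M₂(𝓞/ℓ)` acts, Hecke operators `T_π` for all primes `π`
    {φ : BianchiHecke.allPrimes (𝓞 K) → k |
      ∃ (E : Type*) (_ : AddCommGroup E) (_ : Module k E) (_ : FiniteDimensional k E)
        (ρ : Representation k (BianchiHecke.M2 (𝓞 K ⧸ Ideal.span {(ℓ : 𝓞 K)}))ᵐᵒᵖ E),
        BianchiHecke.IsHeckeEigensystem 𝔞 h𝔞 _ (BianchiHecke.inflate _ ρ) φ}.Finite := by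
  have hfg := BianchiHecke.fg_Gamma1 hquad himag hclass h𝔞
  have hℓ0 : Ideal.span {(ℓ : 𝓞 K)} ≠ ⊥ := by
    rw [Ne, Ideal.span_singleton_eq_bot, Nat.cast_eq_zero]
    exact hℓ.ne_zero
  have : Finite (𝓞 K ⧸ Ideal.span {(ℓ : 𝓞 K)}) := Ideal.finiteQuotientOfFreeOfNeBot _ hℓ0
  refine ⟨(BianchiHecke.finite_setOf_isHeckeEigensystem 𝔞 h𝔞 _ (Ideal.span {(ℓ : 𝓞 K)}) hfg).subset ?_,
    BianchiHecke.finite_setOf_isHeckeEigensystem 𝔞 h𝔞 _ (Ideal.span {(ℓ : 𝓞 K)}) hfg⟩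
  -- Extension by zero turns each $\mathrm{GL}_2$-module into an $\mathrm M_2$-module, so the first
  -- family sits inside one of the second kind, with fewer Hecke operators.
  rintro φ ⟨E, _, _, _, ρ, hφ⟩
  exact ⟨E, _, _, inferInstance, BianchiHecke.extendByZero ρ, hφ⟩
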